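/- **Setting.** Let $\mathcal A$ be a finite, totally ordered alphabet and $p:\mathcal A\times\mathcal A^{\mathbb N}\to[0,1]$ a probability kernel: for each past $a_{-\infty}^{-1}=(a_{-1},a_{-2},\dots)$, $p(\cdot\mid a_{-\infty}^{-1})$ is a probability on $\mathcal A$. Strings are written from the present to the past, $a_{-n}^{-1}=(a_{-1},\dots,a_{-n})$, and juxtaposition of strings is concatenation. Extend $p$ to finite strings by $p(a_{-n}^{-1}\mid a_{-\infty}^{-(n+1)})=p(a_{-(n-1)}^{-1}\mid a_{-\infty}^{-n})\,p(a_{-n}\mid a_{-\infty}^{-(n+1)})$. The set of admissible histories is $$\mathcal H=\Big\{a_{-\infty}^{-1}: \sup_{b}p(a_{-n}^{-1}\mid b_{-\infty}^{-(n+1)})>0\ \text{ for all } n\ge1\Big\},$$ and it is assumed to be invariant under addition of possible symbols: if $a_{-\infty}^{-1}\in\mathcal H$ and $p(g\mid a_{-\infty}^{-1})>0$, then $g\,a_{-\infty}^{-1}\in\mathcal H$. Let $*\notin\mathcal A$ be an extra symbol ("unknown"). For a (possibly empty) string $b_{-n}^{-1}$ over $\mathcal A\cup\{*\}$ let $\alpha(g\mid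 b_{-n}^{-1})=\inf\{p(g\mid a_{-\infty}^{-1}): a_{-\infty}^{-1}\in\mathcal H,\ a_{-j}=b_{-j}\text{ whenever } 1\le j\le n,\ b_{-j}\in\mathcal A\}$ with $\inf\emptyset=0$, and $\beta(b_{-n}^{-1})=\sum_{g}\alpha(g\mid b_{-n}^{-1})$; let $\beta$ be the value of $\beta(\cdot)$ at the empty string. Let $\beta_n=\inf\{\beta(a_{-n}^{-1}):a_{-\infty}^{-1}\in\mathcal H\}$ and, if $\beta_n>0$, let $p^{[n]}_{Markov}(g\mid b_{-n}^{-1})=\alpha(g\mid b_{-n}^{-1})/\beta(b_{-n}^{-1})$, regarded as a Markov chain on the set of the length-$n$ beginnings of admissible histories. Let $\hat n$ be the least $n\ge1$ such that $\beta_n>0$ and this chain has exactly one closed communicating class and that class is aperiodic. **Assumption.** $\beta=0$ and $\hat n<\infty$. Let $\mathcal U$ be the unique closed class of $p^{[\hat n]}_{Markov}$, $\mathcal C=\{a_{-\hat n}^{-1}:a_{-\infty}^{-1}\in\mathcal H\}$, and for $n\ge1$ $$\tilde\rho_n=\sum_{x\in\mathcal U}\ \sum_{a_{-n}^{-1}\in\mathcal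 A^n}\alpha(a_{-n}\mid x)\,\alpha(a_{-(n-1)}\mid a_{-n}x)\cdots\alpha(a_{-1}\mid a_{-n}^{-2}x).$$ **The algorithm.** Let $(U_m^a)_{m\in\mathbb Z,\,a\in\mathcal C}$ be i.i.d. uniform random variables on $[0,1)$. Below $\inf\emptyset=*$. For a time $l$ and $a\in\mathcal C$, the process started at $l$ from the fixed past $a$ is, for $m\ge l$, $$X^a_m=\inf\Big\{g\in\mathcal A:U^a_m<\sum_{b\le g}\alpha\big(b\mid (X^a)_l^{m-1}a\big)\Big\}.$$ Let $n_0$ be the least $m\ge\hat n$ such that, for each $b\in\mathcal U$, with positive probability the last $\hat n$ of the first $m$ values of the processes started from all the $a\in\mathcal C$ at one time $l$ form the string $b$, simultaneously for all $a\in\mathcal C$. For $j\in\mathbb Z$ let $I_j=\{l_j,\dots,r_j\}$ with $l_j=n_0(j-1)+1$, $r_j=n_0j$. The temporary values $X_m^{(j)}\in\mathcal A\cup\{*\}$, which use only the windows $I_j,I_{j+1},\dots$, are as follows. * If $m\in I_j$: $X^{(j)}_m=g$ if the processes started at $l_j$ satisfy $X_m^a=g$ for all $a\in\mathcal C$, with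 $g\in\mathcal A$; otherwise $X^{(j)}_m=*$. If $m<l_j$, then $X^{(j)}_m=*$. * If $m\in I_k$ with $k>j$: if $X_m^{(j+1)}\ne*$, then $X_m^{(j)}=X_m^{(j+1)}$. If $X_m^{(j+1)}=*$ and $(X^{(j)})_{l_k-\hat n}^{l_k-1}$ is not an element of $\mathcal C$, then $X^{(j)}_m=*$. If $X_m^{(j+1)}=*$ and $(X^{(j)})_{l_k-\hat n}^{l_k-1}=b\in\mathcal C$, write $w=(X^{(j)})_{l_j}^{m-1}$ and $$R(w')=\inf\Big\{g\in\mathcal A:U_m^{b}<\beta(w')+\sum_{h\le g}\big(\alpha(h\mid w)-\alpha(h\mid w')\big)\Big\}.$$ If also $(X^{(j+1)})_{l_k-\hat n}^{l_k-1}=b$, then $X_m^{(j)}=R\big((X^{(j+1)})_{l_{j+1}}^{m-1}\big)$. If not, let $X^b$ be started at $l_k$; then $X^{(j)}_m=X^b_m$ if $X^b_m\neq *$, and $X^{(j)}_m=R\big((X^b)_{l_k}^{m-1}b\big)$ if $X^b_m=*$. For $n\in I_z$ let $\tilde T[n]=\sup\{j\le z:X_n^{(j)}\ne*\}$ (with $\sup\emptyset=-\infty$),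 and let $\tilde T[m,n]=\inf_{m\le k\le n}\tilde T[k]$ and $\tilde T[m,+\infty)=\inf_{k\ge m}\tilde T[k]$. **Theorem 5.** Under the above assumptions, suppose that there is $c>0$ such that $\lim_{n\to\infty}\tilde\rho_n\ge c$. Then 1. $\mathbb E(|\tilde T[0]|)<\infty$; 2. $\mathbb E(|\tilde T[0,n]|)<\infty$ for every $n\ge1$; 3. $\mathbb P(|\tilde T[0,+\infty)|<+\infty)=1$. -/

import Mathlib

open MeasureTheory ProbabilityTheory Filter Topology

/-- A probability kernel on a finite alphabet `A`. A past `a_{-∞}^{-1}` is a function `x : ℕ → A`,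
read from the present to the past: `x k = a_{-(k+1)}`. -/
structure ProbKernel (A : Type*) [Fintype A] where
  /-- `prob g x` is `p(g | x)` -/
  prob : A → (ℕ → A) → ℝ
  nonneg : ∀ g x, 0 ≤ prob g x
  sum_eq_one : ∀ x, ∑ g, prob g x = 1

namespace ProbKernel

noncomputable section

open scoped Classical

variable {A : Type*} [Fintype A] [LinearOrder A]

/-- Concatenation of a finite string (most recent symbol first) and an infinite past. -/
def prepend (w : List A) (y : ℕ → A) : ℕ → A := fun k => (w[k]?).getD (y (k - w.length))

/-- `p(w | y)`, the conditional probability of a finite string `w` (most recent symbol first)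
given the infinite past `y`. -/
def wordProb (p : ProbKernel A) : List A → (ℕ → A) → ℝ
  | [], _ => 1
  | g :: w, y => p.prob g (prepend w y) * p.wordProb w y

/-- The set `H` of admissible histories: every finite initial piece is possible, that is, has
positive conditional probability given some past (equivalently, the supremum of these conditional
probabilities over all pasts is positive). -/
def admissible (p : ProbKernel A) : Set (ℕ → A) :=
  {x | ∀ n : ℕ, 1 ≤ n → ∃ y : ℕ → A, 0 < p.wordProb (List.ofFn fun i : Fin n => x i) y}

/-- `α(g | w)` for a finite string `w` (most recent symbol first) over `A ∪ {*}`. The extended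
alphabet is `WithTop A`, and `*` is `⊤`. By Lean's convention the infimum of the empty set of reals
is `0`, and for the empty string this is `α(g)`. -/
def alpha (p : ProbKernel A) (g : A) (w : List (WithTop A)) : ℝ :=
  sInf {r : ℝ | ∃ x ∈ p.admissible,
    (∀ (j : ℕ) (c : A), w[j]? = some (c : WithTop A) → x j = c) ∧ r = p.prob g x}

/-- `β(w) = ∑_g α(g | w)`; for the empty string this is `β`. -/
def beta (p : ProbKernel A) (w : List (WithTop A)) : ℝ := ∑ g, p.alpha g w

/-- A block of `n` known symbols as a string over `A ∪ {*}`; `w i` is the symbol at `-(i+1)`. -/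
def str {n : ℕ} (w : Fin n → A) : List (WithTop A) := List.ofFn fun i => (w i : WithTop A)

/-- The set of strings of length `n` that begin some admissible history. -/
abbrev Past (p : ProbKernel A) (n : ℕ) : Type _ :=
  {w : Fin n → A // ∃ x ∈ p.admissible, ∀ i : Fin n, x i = w i}

/-- `β_n`, the infimum of `β(a_{-n}^{-1})` over the admissible histories `a`. -/
def betaInf (p : ProbKernel A) (n : ℕ) : ℝ :=
  sInf {r : ℝ | ∃ x ∈ p.admissible, r = p.beta (str fun i : Fin n => x i)}

/-- `p_Markov^{[n]}(g | b) = α(g | b) / β(b)`. -/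
def pMarkov (p : ProbKernel A) (n : ℕ) (g : A) (b : p.Past n) : ℝ :=
  p.alpha g (str b.1) / p.beta (str b.1)

/-- The transition matrix of the `n`-step Markov chain with kernel `p_Markov^{[n]}`, as a chain on
strings of length `n`: from `b` one moves to the `n` most recent symbols of the string `g b`. -/
def markovMatrix (p : ProbKernel A) (n : ℕ) : Matrix (p.Past n) (p.Past n) ℝ :=
  fun b b' => ∑ g : A,
    if b'.1 = Fin.init (Fin.cons g b.1 : Fin (n + 1) → A) then p.pMarkov n g b else 0

/-- `j` is accessible from `i` (in some number `m ≥ 0` of steps). -/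
def Accessible {S : Type*} [Fintype S] (P : Matrix S S ℝ) (i j : S) : Prop :=
  ∃ m : ℕ, 0 < (P ^ m) i j

/-- `K` is a closed communicating class of the transition matrix `P`. -/
def IsClosedClass {S : Type*} [Fintype S] (P : Matrix S S ℝ) (K : Set S) : Prop :=
  K.Nonempty ∧ (∀ i ∈ K, ∀ j, j ∈ K ↔ Accessible P i j ∧ Accessible P j i) ∧
    ∀ i ∈ K, ∀ j ∉ K, P i j = 0

/-- Every state of `K` has period `1`: the greatest common divisor of the possible return times
`m ≥ 1` is `1`. -/
def IsAperiodicClass {S : Type*} [Fintype S] (P : Matrix S S ℝ) (K : Set S) : Prop :=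
  ∀ i ∈ K, ∀ d : ℕ, (∀ m : ℕ, 1 ≤ m → 0 < (P ^ m) i i → d ∣ m) → d = 1

/-- `β_n > 0`, and the chain of order `n` has exactly one closed communicating class, and this
class is aperiodic. -/
def GoodOrder (p : ProbKernel A) (n : ℕ) : Prop :=
  1 ≤ n ∧ 0 < p.betaInf n ∧ (∃! K, IsClosedClass (p.markovMatrix n) K) ∧
    ∀ K, IsClosedClass (p.markovMatrix n) K → IsAperiodicClass (p.markovMatrix n) K

/-- `n̂`, the least good order (meaningful when there is one). -/
def nHat (p : ProbKernel A) : ℕ := sInf {n | p.GoodOrder n}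

/-- The standing assumption on a kernel over a finite alphabet: `β = 0` and `n̂ < ∞`. -/
def StandingAssumption (p : ProbKernel A) : Prop :=
  p.beta [] = 0 ∧ ∃ n, p.GoodOrder n

/-- The set `C` of the strings of length `n̂` that begin some admissible history. -/
abbrev Start (p : ProbKernel A) : Type _ := p.Past p.nHat

/-- `𝒰`, the unique closed class of `p_Markov^{[n̂]}`. -/
def closedClass (p : ProbKernel A) : Set p.Start :=
  {b | ∃ K, IsClosedClass (p.markovMatrix p.nHat) K ∧ b ∈ K}

/-- The product `α(a_{-n} | x) α(a_{-(n-1)} | a_{-n} x) ⋯ α(a_{-1} | a_{-n}^{-2} x)`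
for the string `a` (most recent symbol first) and the past string `x`. -/
def alphaProd (p : ProbKernel A) : List A → List (WithTop A) → ℝ
  | [], _ => 1
  | g :: w, x => p.alpha g (w.map (fun c => (c : WithTop A)) ++ x) * p.alphaProd w x

/-- `ρ̃_n`. -/
def rhoTilde (p : ProbKernel A) (n : ℕ) : ℝ :=
  ∑ x : p.closedClass, ∑ a : Fin n → A, p.alphaProd (List.ofFn a) (str x.1.1)

/-- `inf {g : u < F g}`, with `inf ∅ = *`. -/
def firstBelow (u : ℝ) (F : A → ℝ) : WithTop A :=
  (Finset.univ.filter fun g => u < F g).min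

/-- `inf {g : u < ∑_{b ≤ g} α(b | w)}`. -/
def draw (p : ProbKernel A) (u : ℝ) (w : List (WithTop A)) : WithTop A :=
  firstBelow u fun g => ∑ b ∈ Finset.univ.filter (· ≤ g), p.alpha b w

/-- `inf {g : u < β(w') + ∑_{b ≤ g} (α(b | w) - α(b | w'))}`. -/
def redraw (p : ProbKernel A) (u : ℝ) (w w' : List (WithTop A)) : WithTop A :=
  firstBelow u fun g =>
    p.beta w' + ∑ b ∈ Finset.univ.filter (· ≤ g), (p.alpha b w - p.alpha b w')

/-- The first `t` values (most recent first) of the process with fixed past `a` driven by the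
numbers `v 0, v 1, …`. -/
def traj (p : ProbKernel A) (v : ℕ → ℝ) (a : List (WithTop A)) : ℕ → List (WithTop A)
  | 0 => []
  | t + 1 => p.draw (v t) (p.traj v a t ++ a) :: p.traj v a t

/-- `n₀`: the least `m ≥ n̂` such that, for each `b ∈ 𝒰`, with positive probability the last `n̂` of
the first `m` values of all the processes `Y^a`, `a ∈ C`, (driven by `V_0^a, V_1^a, …`)
form the string `b`. -/
def nZero (p : ProbKernel A) {Ω : Type*} [MeasurableSpace Ω] (μ : Measure Ω)
    (V : ℕ → p.Start → Ω → ℝ) : ℕ :=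
  sInf {m : ℕ | p.nHat ≤ m ∧ ∀ b ∈ p.closedClass,
    0 < μ {ω | ∀ a : p.Start, (p.traj (fun t => V t a ω) (str a.1) m).take p.nHat = str b.1}}

/-- `l_j = n₀ (j - 1) + 1`, the first time of the window `I_j = {n₀ (j - 1) + 1, …, n₀ j}`. -/
def winStart (n0 : ℕ) (j : ℤ) : ℤ := n0 * (j - 1) + 1

/-- The index `z` of the window with `n ∈ I_z`. -/
def winIndex (n0 : ℕ) (n : ℤ) : ℤ := (n - 1) / n0 + 1

/-- The values `X^a_{l}, …, X^a_{l+t-1}` (most recent first) of the process started at time `l`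
from the fixed past `a`, using the numbers `u_m^a`. -/
def startTraj (p : ProbKernel A) (u : ℤ → p.Start → ℝ) (l : ℤ) (a : p.Start) (t : ℕ) :
    List (WithTop A) :=
  p.traj (fun i => u (l + i) a) (str a.1) t

/-- The common value `g ∈ A` of the `X^a_{l+t}`, `a ∈ C`, if there is one, and `*` if not. -/
def coalesced (p : ProbKernel A) (u : ℤ → p.Start → ℝ) (l : ℤ) (t : ℕ) : WithTop A :=
  if h : ∃ g : A, ∀ a : p.Start, (p.startTraj u l a (t + 1)).headD ⊤ = (g : WithTop A) then
    (h.choose : WithTop A)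
  else ⊤

/-- The string `X^{(j)}_{l_j}, …, X^{(j)}_{l_j+t-1}` (most recent first) of the temporary values
obtained from the windows `I_j, I_{j+1}, …` only.

The value at `m = l_j + t` is computed as follows. In the window `I_j` it is the common value of the
trajectories started at `l_j` from all of `C`, if there is one. In a later window `I_k`, the value
`X^{(j+1)}_m` is kept if it is known. Otherwise, if the `n̂` values of `X^{(j)}` before `l_k` form
a string `b ∈ C`, the process that belongs to `b` is used with `u_m^b`: if they had been known to
`X^{(j+1)}` already, its value is updated from `X^{(j+1)}`; if not, the value `X^b_m` of the
trajectory started at `l_k` from `b` is taken if it is known, and updated from that trajectory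
if it is `*`. -/
def history (p : ProbKernel A) (n0 : ℕ) (u : ℤ → p.Start → ℝ) : ℕ → ℤ → List (WithTop A)
  | 0, _ => []
  | t + 1, j =>
    let cur := p.history n0 u t j
    let m := winStart n0 j + t
    let new : WithTop A :=
      if _hw : 0 < n0 ∧ n0 ≤ t then
        let old' := p.history n0 u (t - n0 + 1) (j + 1)
        let oldVal := old'.headD ⊤
        let old := old'.tail
        let i := t % n0
        if oldVal ≠ ⊤ then oldVal
        else if hb : ∃ b : p.Start, (cur.drop i).take p.nHat = str b.1 then
          let b := hb.choose
          if (old.drop i).take p.nHat = str b.1 then p.redraw (u m b) cur old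
          else
            let l := m - i
            let xb := (p.startTraj u l b (i + 1)).headD ⊤
            if xb ≠ ⊤ then xb
            else p.redraw (u m b) cur (p.startTraj u l b i ++ str b.1)
        else ⊤
      else p.coalesced u (winStart n0 j) t
    new :: cur
termination_by t => t
decreasing_by all_goals omega

/-- The temporary value `X^{(j)}_n` (it is `*` if `n` is before the window `I_j`). -/
def tempValue (p : ProbKernel A) (n0 : ℕ) (u : ℤ → p.Start → ℝ) (j n : ℤ) : WithTop A :=
  (p.history n0 u (n - winStart n0 j + 1).toNat j).headD ⊤

/-- `T̃[n] = sup {j ≤ z : X^{(j)}_n ≠ *}`, where `n ∈ I_z`; it is `-∞` if there is no such `j`. -/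
def Ttilde (p : ProbKernel A) (n0 : ℕ) (u : ℤ → p.Start → ℝ) (n : ℤ) : EReal :=
  ⨆ (j : ℤ) (_ : j ≤ winIndex n0 n ∧ p.tempValue n0 u j n ≠ ⊤), ((j : ℝ) : EReal)

/-- `T̃[m, n] = inf {T̃[k] : m ≤ k ≤ n}`. -/
def TtildeIcc (p : ProbKernel A) (n0 : ℕ) (u : ℤ → p.Start → ℝ) (m n : ℤ) : EReal :=
  ⨅ k ∈ Set.Icc m n, p.Ttilde n0 u k

/-- `T̃[m, +∞) = inf {T̃[k] : k ≥ m}`. -/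
def TtildeIci (p : ProbKernel A) (n0 : ℕ) (u : ℤ → p.Start → ℝ) (m : ℤ) : EReal :=
  ⨅ k ∈ Set.Ici m, p.Ttilde n0 u k

end

end ProbKernel

namespace ProbKernel

open scoped Classical

set_option linter.unusedSectionVars false

variable {A : Type*} [Fintype A] [LinearOrder A]

/-! Window `I_j` makes an attempt: all trajectories started at `l_j` end the window with one common
string `x ∈ 𝒰`, and afterwards every `X^{(j)}` is known. The proof shows that some attempt lasts
forever with positive probability, and then runs a renewal argument.

Survival. Suppose the attempt has succeeded so far and `X^{(j)}` has followed the word `a` after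
`x`. The next value is then a function of one fresh uniform variable and has law `α(· | history)`
(`exists_hasLaw_value`): stage by stage, redrawing adds to the old law exactly the mass gained from
the finer string. The history knows at least `a x`, so the symbol `g` appears with conditional
probability at least `α(g | a x)` (`alpha_mul_measure_followsPath_le`). Multiplying along words and
summing over them bounds survival for `n` steps below by the `x`-term of `ρ̃_n` times the
probability of coalescing to `x`. That term decreases in `n`, so some `x` has a positive limit
(`exists_rho_ge`). Coalescence to `x` has positive probability because the chain has a single closed
class, which is aperiodic, and so `n₀` is genuine (`nZero_spec`).

Renewal. Let `q > 0` be the probability of surviving forever and `b_M` the probability that no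
attempt from the windows `0, …, M - 1` survives window `M`. This last event is independent of
eternal survival from window `M + 1`, and the joint events are disjoint for indices at least two
apart. Hence `q ∑ b_M ≤ 2` (`tsum_measure_noSurvivor_ne_top`). If `T̃[n] < -N` and `n` lies in
window `K`, no attempt from `-N, …, K - 1` survives window `K`, an event of probability `b_{N+K}`.
Summing over `N` gives the expectations; tails of `∑ b_M` give the almost sure statement. -/

/-! ### Strings with unknown symbols, and refinement. -/

/-- The infinite past `h` agrees with the known symbols of `w`. -/
def Fits (h : ℕ → A) (w : List (WithTop A)) : Prop :=
  ∀ (k : ℕ) (c : A), w[k]? = some (c : WithTop A) → h k = c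

/-- Some admissible history agrees with the known symbols of `w`. -/
def Consistent (p : ProbKernel A) (w : List (WithTop A)) : Prop := ∃ h ∈ p.admissible, Fits h w

/-- Every symbol known in `w'` is known in `w`. -/
def Refines (w w' : List (WithTop A)) : Prop :=
  ∀ (k : ℕ) (c : A), w'[k]? = some (c : WithTop A) → w[k]? = some (c : WithTop A)

lemma Refines.refl (w : List (WithTop A)) : Refines w w := fun _ _ h => h

lemma Refines.nil (w : List (WithTop A)) : Refines w [] := fun k c h => by simp at h

lemma Refines.trans {w w' w'' : List (WithTop A)} (h : Refines w w') (h' : Refines w' w'') :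
    Refines w w'' := fun k c hk => h k c (h' k c hk)

lemma Fits.mono {h : ℕ → A} {w w' : List (WithTop A)} (hw : Fits h w) (hr : Refines w w') :
    Fits h w' := fun k c hk => hw k c (hr k c hk)

lemma Consistent.mono {p : ProbKernel A} {w w' : List (WithTop A)} (hw : p.Consistent w)
    (hr : Refines w w') : p.Consistent w' := by
  obtain ⟨h, h1, h2⟩ := hw
  exact ⟨h, h1, h2.mono hr⟩

lemma Refines.cons {x y : WithTop A} {w w' : List (WithTop A)} (hxy : y ≠ ⊤ → x = y)
    (hr : Refines w w') : Refines (x :: w) (y :: w') := by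
  intro k c hk
  cases k with
  | zero =>
    simp only [List.getElem?_cons_zero, Option.some.injEq] at hk ⊢
    rw [hxy (by simp [hk]), hk]
  | succ k => simpa using hr k c (by simpa using hk)

lemma Refines.append {v w w' : List (WithTop A)} (hr : Refines w w') :
    Refines (v ++ w) (v ++ w') := by
  induction v with
  | nil => exact hr
  | cons x v ih => exact Refines.cons (fun _ => rfl) ih

lemma Refines.append_left (v w : List (WithTop A)) : Refines (v ++ w) v := by
  intro k c hk
  rw [List.getElem?_append_left (by by_contra h; simp [not_lt.mp h] at hk)]
  exact hk

lemma refines_take (w : List (WithTop A)) (n : ℕ) : Refines w (w.take n) := by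
  intro k c hk
  rw [List.getElem?_take] at hk
  split_ifs at hk
  exact hk

lemma str_getElem? {n : ℕ} (w : Fin n → A) (k : ℕ) (c : A) :
    (str w)[k]? = some (c : WithTop A) ↔ ∃ h : k < n, w ⟨k, h⟩ = c := by
  unfold str
  rw [List.getElem?_eq_some_iff]
  simp

lemma length_str {n : ℕ} (w : Fin n → A) : (str w).length = n := by simp [str]

lemma str_injective {n : ℕ} : Function.Injective (str : (Fin n → A) → List (WithTop A)) := by
  intro w w' h
  have := List.ofFn_injective h
  funext i
  simpa using congrFun this i

lemma take_eq_str_of_refines {n : ℕ} {w : List (WithTop A)} {b : Fin n → A}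
    (hr : Refines w (str b)) : w.take n = str b := by
  apply List.ext_getElem?
  intro k
  by_cases hk : k < n
  · have h1 : (str b)[k]? = some (b ⟨k, hk⟩ : WithTop A) := (str_getElem? b k _).2 ⟨hk, rfl⟩
    rw [List.getElem?_take_of_lt hk, h1]
    exact hr _ _ h1
  · rw [List.getElem?_eq_none (by simp; omega), List.getElem?_eq_none (by simp [length_str]; omega)]

lemma refines_str_of_take_eq {n : ℕ} {w : List (WithTop A)} {b : Fin n → A}
    (h : w.take n = str b) : Refines w (str b) := h ▸ refines_take w n

/-! ### Monotonicity of `α` and `β`. -/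

section Alpha

variable (p : ProbKernel A)

lemma alpha_nonneg (g : A) (w : List (WithTop A)) : 0 ≤ p.alpha g w := by
  apply Real.sInf_nonneg
  rintro r ⟨x, -, -, rfl⟩
  exact p.nonneg _ _

variable {p}

lemma alpha_le {h : ℕ → A} (hh : h ∈ p.admissible) {w : List (WithTop A)} (hf : Fits h w) (g : A) :
    p.alpha g w ≤ p.prob g h := by
  apply csInf_le
  · refine ⟨0, ?_⟩
    rintro r ⟨x, -, -, rfl⟩
    exact p.nonneg _ _
  · exact ⟨h, hh, hf, rfl⟩

/-- A finer string leaves fewer histories in the infimum. Consistency keeps that set nonempty;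
otherwise the convention `inf ∅ = 0` would break monotonicity. -/
lemma alpha_mono {w w' : List (WithTop A)} (hw : p.Consistent w) (hr : Refines w w') (g : A) :
    p.alpha g w' ≤ p.alpha g w := by
  obtain ⟨h, hh, hf⟩ := hw
  refine le_csInf ⟨p.prob g h, h, hh, hf, rfl⟩ ?_
  rintro r ⟨x, hx, hfx, rfl⟩
  exact alpha_le hx (Fits.mono hfx hr) g

lemma alpha_eq_zero_of_not_consistent {w : List (WithTop A)} (hw : ¬ p.Consistent w) (g : A) :
    p.alpha g w = 0 := by
  unfold alpha
  convert Real.sInf_empty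
  rw [Set.eq_empty_iff_forall_notMem]
  rintro r ⟨x, hx, hfx, rfl⟩
  exact hw ⟨x, hx, hfx⟩

variable (p) in
lemma beta_nonneg (w : List (WithTop A)) : 0 ≤ p.beta w :=
  Finset.sum_nonneg fun g _ => p.alpha_nonneg g w

variable (p) in
lemma beta_le_one (w : List (WithTop A)) : p.beta w ≤ 1 := by
  by_cases hw : p.Consistent w
  · obtain ⟨h, hh, hf⟩ := hw
    rw [← p.sum_eq_one h]
    exact Finset.sum_le_sum fun g _ => alpha_le hh hf g
  · simp [beta, alpha_eq_zero_of_not_consistent hw]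

lemma beta_mono {w w' : List (WithTop A)} (hw : p.Consistent w) (hr : Refines w w') :
    p.beta w' ≤ p.beta w :=
  Finset.sum_le_sum fun g _ => alpha_mono hw hr g

lemma prepend_nil (y : ℕ → A) : prepend [] y = y := by
  funext k; simp [prepend]

lemma prepend_cons (g : A) (w : List A) (y : ℕ → A) :
    prepend (g :: w) y = prepend [g] (prepend w y) := by
  funext k
  cases k with
  | zero => simp [prepend]
  | succ k => simp [prepend]

lemma Fits.cons {h : ℕ → A} {w : List (WithTop A)} (hf : Fits h w) {g : A} {v : WithTop A}
    (hv : ∀ c : A, v = c → g = c) : Fits (prepend [g] h) (v :: w) := by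
  intro k c hk
  cases k with
  | zero =>
    simp only [List.getElem?_cons_zero, Option.some.injEq] at hk
    simpa [prepend] using hv c hk
  | succ k => simpa [prepend] using hf k c (by simpa using hk)

end Alpha

/-! ### Admissible extensions and weights of words. -/

/-- The set of admissible histories is invariant under addition of possible symbols. -/
def Extendable (p : ProbKernel A) : Prop :=
  ∀ x ∈ p.admissible, ∀ g : A, 0 < p.prob g x → prepend [g] x ∈ p.admissible

lemma Extendable.exists_prob_pos {p : ProbKernel A} (x : ℕ → A) : ∃ g, 0 < p.prob g x := by
  by_contra! h
  have := p.sum_eq_one x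
  rw [Finset.sum_eq_zero (fun g _ => le_antisymm (h g) (p.nonneg g x))] at this
  exact zero_ne_one this

/-- A string of known symbols as a string over the extended alphabet. -/
def known (a : List A) : List (WithTop A) := a.map WithTop.some

@[simp] lemma known_cons (g : A) (a : List A) : known (g :: a) = (g : WithTop A) :: known a := rfl

lemma alphaProd_cons (p : ProbKernel A) (g : A) (a : List A) (x : List (WithTop A)) :
    p.alphaProd (g :: a) x = p.alpha g (known a ++ x) * p.alphaProd a x := by
  rw [alphaProd]
  congr 3
  induction a with
  | nil => rfl
  | cons b a ih => simp_all [known]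

lemma alphaProd_nonneg (p : ProbKernel A) (a : List A) (x : List (WithTop A)) :
    0 ≤ p.alphaProd a x := by
  induction a with
  | nil => simp [alphaProd]
  | cons g a ih => rw [alphaProd_cons]; exact mul_nonneg (p.alpha_nonneg _ _) ih

lemma pos_of_alphaProd_cons_pos {p : ProbKernel A} {g : A} {a : List A} {x : List (WithTop A)}
    (h : 0 < p.alphaProd (g :: a) x) :
    0 < p.alpha g (known a ++ x) ∧ 0 < p.alphaProd a x := by
  have h1 := p.alpha_nonneg g (known a ++ x)
  have h2 := p.alphaProd_nonneg a x
  rw [alphaProd_cons] at h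
  exact ⟨lt_of_le_of_ne h1 (by rintro h3; simp [← h3] at h),
    lt_of_le_of_ne h2 (by rintro h3; simp [← h3] at h)⟩

/-- A positive factor `α` bounds `p` from below at every admissible history that fits, so each
symbol of the word is possible and can be added in turn. The string `s` may know more than `x`: this
is the case for an actual history after coalescence. -/
lemma Extendable.prepend_of_alphaProd_pos {p : ProbKernel A} (hadd : p.Extendable) {a : List A}
    {x s : List (WithTop A)} (hr : Refines s x) {h : ℕ → A} (hh : h ∈ p.admissible)
    (hf : Fits h s) (hpos : 0 < p.alphaProd a x) :
    prepend a h ∈ p.admissible ∧ Fits (prepend a h) (known a ++ s) := by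
  induction a with
  | nil => simpa [prepend_nil] using ⟨hh, hf⟩
  | cons g a ih =>
    obtain ⟨h1, h2⟩ := pos_of_alphaProd_cons_pos hpos
    obtain ⟨ih1, ih2⟩ := ih h2
    rw [prepend_cons]
    refine ⟨hadd _ ih1 g (h1.trans_le (alpha_le ih1 (ih2.mono hr.append) g)), ?_⟩
    exact ih2.cons (by simp)

/-! ### Drawing and redrawing with one uniform variable. -/

section Draw

lemma firstBelow_eq_coe_iff (u : ℝ) (F : A → ℝ) (g : A) :
    firstBelow u F = (g : WithTop A) ↔ u < F g ∧ ∀ g' < g, F g' ≤ u := by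
  unfold firstBelow
  constructor
  · intro h
    have h1 := Finset.mem_of_min h
    refine ⟨by simpa using h1, fun g' hg' => ?_⟩
    by_contra! hlt
    have := Finset.min_le (s := Finset.univ.filter fun g => u < F g) (a := g') (by simpa using hlt)
    rw [h] at this
    exact absurd hg' (not_lt.2 (WithTop.coe_le_coe.1 this))
  · rintro ⟨h1, h2⟩
    apply le_antisymm
    · exact Finset.min_le (by simpa using h1)
    · apply Finset.le_min
      intro a ha
      simp only [Finset.mem_filter, Finset.mem_univ, true_and] at ha
      by_contra! hlt
      exact absurd (h2 a (WithTop.coe_lt_coe.1 hlt)) (not_le.2 ha)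

lemma firstBelow_eq_top_iff (u : ℝ) (F : A → ℝ) :
    firstBelow u F = ⊤ ↔ ∀ g, F g ≤ u := by
  unfold firstBelow
  rw [Finset.min_eq_top, Finset.filter_eq_empty_iff]
  simp

/-- The sum of `d` over the symbols before `g`. -/
def sumBefore (d : A → ℝ) (g : A) : ℝ := ∑ b ∈ Finset.univ.filter (· < g), d b

lemma sum_filter_le (d : A → ℝ) (g : A) :
    ∑ b ∈ Finset.univ.filter (· ≤ g), d b = sumBefore d g + d g := by
  unfold sumBefore
  have : Finset.univ.filter (· ≤ g) = insert g (Finset.univ.filter (· < g)) := by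
    ext b; simp [le_iff_eq_or_lt]
  rw [this, Finset.sum_insert (by simp), add_comm]

lemma sumBefore_nonneg {d : A → ℝ} (hd : ∀ a, 0 ≤ d a) (g : A) : 0 ≤ sumBefore d g :=
  Finset.sum_nonneg fun _ _ => hd _

lemma sumBefore_add_le {d : A → ℝ} (hd : ∀ a, 0 ≤ d a) (g : A) :
    sumBefore d g + d g ≤ ∑ b, d b := by
  rw [← sum_filter_le]
  exact Finset.sum_le_sum_of_subset_of_nonneg (Finset.subset_univ _) fun _ _ _ => hd _

/-- The partial sums increase, so only the one at the predecessor of `g` matters; `c ≤ u` covers the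
case of no predecessor. -/
lemma firstBelow_cumul {d : A → ℝ} (hd : ∀ a, 0 ≤ d a) {c u : ℝ} (hc : c ≤ u) (g : A) :
    firstBelow u (fun g => c + ∑ b ∈ Finset.univ.filter (· ≤ g), d b) = (g : WithTop A) ↔
      c + sumBefore d g ≤ u ∧ u < c + sumBefore d g + d g := by
  rw [firstBelow_eq_coe_iff, sum_filter_le, and_comm, add_assoc]
  refine and_congr_left fun _ => ⟨fun h => ?_, fun h g' hg' => ?_⟩
  · rcases (Finset.univ.filter (· < g)).eq_empty_or_nonempty with he | hne
    · simpa [sumBefore, he] using hc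
    · set m := (Finset.univ.filter (· < g)).max' hne
      have hm : m < g := (Finset.mem_filter.1 (Finset.max'_mem _ hne)).2
      have := h m hm
      convert this using 2
      unfold sumBefore
      congr 1
      ext b
      simp only [Finset.mem_filter, Finset.mem_univ, true_and]
      exact ⟨fun hb => Finset.le_max' _ _ (by simpa using hb), fun hb => hb.trans_lt hm⟩
  · refine le_trans ?_ h
    gcongr
    unfold sumBefore
    refine Finset.sum_le_sum_of_subset_of_nonneg (fun b hb => ?_) fun _ _ _ => hd _
    simp only [Finset.mem_filter, Finset.mem_univ, true_and] at hb ⊢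
    exact hb.trans_lt hg'

lemma firstBelow_cumul_eq_top {d : A → ℝ} (hd : ∀ a, 0 ≤ d a) {c u : ℝ} (hc : c ≤ u) :
    firstBelow u (fun g => c + ∑ b ∈ Finset.univ.filter (· ≤ g), d b) = ⊤ ↔ c + ∑ b, d b ≤ u := by
  rw [firstBelow_eq_top_iff]
  constructor
  · intro h
    rcases isEmpty_or_nonempty A with he | hne
    · simpa using hc
    · set m := (Finset.univ : Finset A).max' Finset.univ_nonempty
      convert h m using 3
      ext b
      simp [m, Finset.le_max']
  · intro h g
    rw [sum_filter_le]
    linarith [sumBefore_add_le hd g]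

/-- As a function of a uniform variable `v`, `Y v` equals `g` with probability `α(g | w)`, and
it is unknown exactly when `v ≥ β(w)`. -/
def HasLaw (p : ProbKernel A) (Y : ℝ → WithTop A) (w : List (WithTop A)) : Prop :=
  (∀ v, 0 ≤ v → v < 1 → (Y v = ⊤ ↔ p.beta w ≤ v)) ∧
    ∀ g : A, volume {v | v ∈ Set.Ico (0 : ℝ) 1 ∧ Y v = g} = ENNReal.ofReal (p.alpha g w)

variable {p : ProbKernel A}

lemma draw_eq_coe_iff {u : ℝ} (hu : 0 ≤ u) (w : List (WithTop A)) (g : A) :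
    p.draw u w = (g : WithTop A) ↔
      sumBefore (p.alpha · w) g ≤ u ∧ u < sumBefore (p.alpha · w) g + p.alpha g w := by
  have := firstBelow_cumul (d := (p.alpha · w)) (fun a => p.alpha_nonneg a w) hu g
  simp only [zero_add] at this
  exact this

lemma draw_eq_top_iff {u : ℝ} (hu : 0 ≤ u) (w : List (WithTop A)) :
    p.draw u w = ⊤ ↔ p.beta w ≤ u := by
  have := firstBelow_cumul_eq_top (d := (p.alpha · w)) (fun a => p.alpha_nonneg a w) hu
  simp only [zero_add] at this
  exact this

lemma draw_pos {u : ℝ} (hu : 0 ≤ u) {w : List (WithTop A)} {g : A} (h : p.draw u w = g) :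
    0 < p.alpha g w := by
  obtain ⟨h1, h2⟩ := (draw_eq_coe_iff hu w g).1 h
  linarith

lemma setOf_draw_eq (w : List (WithTop A)) (g : A) :
    {v | v ∈ Set.Ico (0 : ℝ) 1 ∧ p.draw v w = g} =
      Set.Ico (sumBefore (p.alpha · w) g) (sumBefore (p.alpha · w) g + p.alpha g w) := by
  ext v
  have hd : ∀ a, 0 ≤ p.alpha a w := fun a => p.alpha_nonneg a w
  constructor
  · rintro ⟨hv, h⟩
    exact (draw_eq_coe_iff hv.1 w g).1 h
  · intro h
    have h0 : 0 ≤ v := (sumBefore_nonneg hd g).trans h.1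
    refine ⟨⟨h0, ?_⟩, (draw_eq_coe_iff h0 w g).2 h⟩
    exact h.2.trans_le ((sumBefore_add_le hd g).trans (p.beta_le_one w))

lemma hasLaw_draw (w : List (WithTop A)) : p.HasLaw (p.draw · w) w := by
  refine ⟨fun v hv _ => draw_eq_top_iff hv w, fun g => ?_⟩
  rw [setOf_draw_eq, Real.volume_Ico]
  congr 1
  ring

/-- Updating a value with the law given by `w'` leads to the law given by a finer string `w`. -/
lemma HasLaw.redraw {Y : ℝ → WithTop A} {w w' : List (WithTop A)} (hY : p.HasLaw Y w')
    (hw : p.Consistent w) (hr : Refines w w') :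
    p.HasLaw (fun v => if Y v ≠ ⊤ then Y v else p.redraw v w w') w := by
  set d : A → ℝ := fun b => p.alpha b w - p.alpha b w' with hddef
  have hd : ∀ a, 0 ≤ d a := fun a => sub_nonneg.2 (alpha_mono hw hr a)
  have hsum : p.beta w' + ∑ b, d b = p.beta w := by
    simp [hddef, beta]
  have hmono := beta_mono hw hr
  constructor
  · intro v h0 h1
    by_cases hv : Y v = ⊤
    · have hv' := (hY.1 v h0 h1).1 hv
      simp only [hv, ne_eq, not_true_eq_false, if_false]
      rw [← hsum]
      exact firstBelow_cumul_eq_top hd hv'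
    · have hv' := mt (hY.1 v h0 h1).2 hv
      simp only [ne_eq, hv, not_false_eq_true, if_true, false_iff]
      linarith
  · intro g
    -- Redrawing acts only where `v ≥ β(w')` and lays the increments `d` end to end from `β(w')`.
    -- Their total is `β(w) - β(w')`, so `g` gains an interval of length `d g` disjoint from its old
    -- set.
    have hsplit : {v | v ∈ Set.Ico (0 : ℝ) 1 ∧
        (if Y v ≠ ⊤ then Y v else p.redraw v w w') = g} =
        {v | v ∈ Set.Ico (0 : ℝ) 1 ∧ Y v = g} ∪
        Set.Ico (p.beta w' + sumBefore d g) (p.beta w' + sumBefore d g + d g) := by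
      ext v
      simp only [Set.mem_ofPred_eq, Set.mem_union]
      constructor
      · rintro ⟨hv, h⟩
        by_cases hY' : Y v = ⊤
        · right
          rw [if_neg (by simpa using hY')] at h
          exact (firstBelow_cumul hd ((hY.1 v hv.1 hv.2).1 hY') g).1 h
        · left
          rw [if_pos hY'] at h
          exact ⟨hv, h⟩
      · rintro (⟨hv, h⟩ | h)
        · refine ⟨hv, ?_⟩
          rw [if_pos (by simp [h]), h]
        · have h0 := sumBefore_nonneg hd g
          have h1 := sumBefore_add_le hd g
          have hb0 := p.beta_nonneg w'
          have hb1 := p.beta_le_one w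
          have hv : v ∈ Set.Ico (0 : ℝ) 1 := ⟨by linarith [h.1], by linarith [h.2]⟩
          have hbv : p.beta w' ≤ v := by linarith [h.1]
          refine ⟨hv, ?_⟩
          rw [if_neg (by simpa using (hY.1 v hv.1 hv.2).2 hbv)]
          exact (firstBelow_cumul hd hbv g).2 h
    rw [hsplit, measure_union _ measurableSet_Ico, hY.2, Real.volume_Ico, add_sub_cancel_left,
      ← ENNReal.ofReal_add (p.alpha_nonneg g w') (hd g)]
    · simp [hddef]
    · rw [Set.disjoint_left]
      rintro v ⟨hv, h⟩ h'
      have := (hY.1 v hv.1 hv.2).2 (by linarith [h'.1, sumBefore_nonneg hd g])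
      simp [h] at this

end Draw

/-! ### The recursion for the temporary values: locality and stationarity. -/

section History

variable (p : ProbKernel A) (n0 : ℕ) (u : ℤ → p.Start → ℝ)

lemma winStart_add (j s : ℤ) : winStart n0 (j + s) = winStart n0 j + n0 * s := by
  unfold winStart; ring

lemma traj_congr {v v' : ℕ → ℝ} (a : List (WithTop A)) {t : ℕ} (h : ∀ i < t, v i = v' i) :
    p.traj v a t = p.traj v' a t := by
  induction t with
  | zero => rfl
  | succ t ih => simp only [traj, ih fun i hi => h i (by omega), h t (by omega)]

lemma startTraj_succ (l : ℤ) (a : p.Start) (t : ℕ) :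
    p.startTraj u l a (t + 1) =
      p.draw (u (l + t) a) (p.startTraj u l a t ++ str a.1) :: p.startTraj u l a t := rfl

variable {p u} in
lemma startTraj_congr {u' : ℤ → p.Start → ℝ} (l : ℤ) (a : p.Start) {t : ℕ}
    (h : ∀ m, l ≤ m → m < l + t → u m a = u' m a) :
    p.startTraj u l a t = p.startTraj u' l a t :=
  traj_congr p _ fun i hi => h _ (by omega) (by omega)

lemma coalesced_congr {u' : ℤ → p.Start → ℝ} (l : ℤ) {t : ℕ}
    (h : ∀ m, l ≤ m → m ≤ l + t → ∀ a, u m a = u' m a) :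
    p.coalesced u l t = p.coalesced u' l t := by
  have : ∀ a, p.startTraj u l a (t + 1) = p.startTraj u' l a (t + 1) := fun a =>
    startTraj_congr l a fun m h1 h2 => h m h1 (by push_cast at h2; omega) a
  unfold coalesced
  simp only [this]

variable {p u} in
lemma headD_startTraj_of_coalesced {l : ℤ} {t : ℕ} (h : p.coalesced u l t ≠ ⊤) (a : p.Start) :
    (p.startTraj u l a (t + 1)).headD ⊤ = p.coalesced u l t := by
  unfold coalesced at h ⊢
  split_ifs at h ⊢ with h1
  · exact h1.choose_spec a
  · exact absurd rfl h

variable {p u} in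
lemma coalesced_eq_coe {l : ℤ} {t : ℕ} {g : A} (a₀ : p.Start)
    (h : ∀ a : p.Start, (p.startTraj u l a (t + 1)).headD ⊤ = (g : WithTop A)) :
    p.coalesced u l t = g := by
  have h1 : ∃ g : A, ∀ a : p.Start, (p.startTraj u l a (t + 1)).headD ⊤ = (g : WithTop A) :=
    ⟨g, h⟩
  unfold coalesced
  rw [dif_pos h1, ← h1.choose_spec a₀, h a₀]

/-- The temporary value at the time `l_j + t`. -/
noncomputable def value (t : ℕ) (j : ℤ) : WithTop A := (p.history n0 u (t + 1) j).headD ⊤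

lemma history_zero (j : ℤ) : p.history n0 u 0 j = [] := by rw [history]

lemma history_succ (t : ℕ) (j : ℤ) :
    p.history n0 u (t + 1) j = p.value n0 u t j :: p.history n0 u t j := by
  unfold value
  rw [history]
  rfl

lemma drop_history (t i : ℕ) (j : ℤ) :
    (p.history n0 u (t + i) j).drop i = p.history n0 u t j := by
  induction i with
  | zero => rfl
  | succ i ih => rw [← add_assoc, history_succ, List.drop_succ_cons, ih]

lemma value_of_lt {t : ℕ} (ht : t < n0) (j : ℤ) :
    p.value n0 u t j = p.coalesced u (winStart n0 j) t := by
  unfold value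
  rw [history, dif_neg (by omega)]
  rfl

/-- The value at the `i`-th time of the window `j + k + 1`. -/
lemma value_window {i : ℕ} (hi : i < n0) (k : ℕ) (j : ℤ) :
    p.value n0 u (n0 * (k + 1) + i) j =
      if p.value n0 u (n0 * k + i) (j + 1) ≠ ⊤ then p.value n0 u (n0 * k + i) (j + 1)
      else if hb : ∃ b : p.Start, (p.history n0 u (n0 * (k + 1)) j).take p.nHat = str b.1 then
        if (p.history n0 u (n0 * k) (j + 1)).take p.nHat = str hb.choose.1 then
          p.redraw (u (winStart n0 (j + k + 1) + i) hb.choose)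
            (p.history n0 u (n0 * (k + 1) + i) j) (p.history n0 u (n0 * k + i) (j + 1))
        else
          if (p.startTraj u (winStart n0 (j + k + 1)) hb.choose (i + 1)).headD ⊤ ≠ ⊤ then
            (p.startTraj u (winStart n0 (j + k + 1)) hb.choose (i + 1)).headD ⊤
          else p.redraw (u (winStart n0 (j + k + 1) + i) hb.choose)
            (p.history n0 u (n0 * (k + 1) + i) j)
            (p.startTraj u (winStart n0 (j + k + 1)) hb.choose i ++ str hb.choose.1)
      else ⊤ := by
  have e1 : n0 * (k + 1) + i - n0 = n0 * k + i := by rw [mul_add]; omega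
  have e2 : (n0 * (k + 1) + i) % n0 = i := by rw [Nat.mul_add_mod, Nat.mod_eq_of_lt hi]
  have e3 : winStart n0 j + ((n0 * (k + 1) + i : ℕ) : ℤ) = winStart n0 (j + k + 1) + i := by
    unfold winStart; push_cast; ring
  have e4 : winStart n0 (j + k + 1) + (i : ℤ) - i = winStart n0 (j + k + 1) := by ring
  rw [value, history, dif_pos (by refine ⟨by omega, ?_⟩; rw [mul_add]; omega)]
  simp only [List.headD_cons, e1, e2, e3, e4, drop_history]
  simp only [history_succ _ _ _ (n0 * k + i), List.headD_cons, List.tail_cons, drop_history]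

-- Locality: stage `j` reads only numbers from `l_j` on, and none later than the value being
-- computed. Independence of events separated in time rests on this.
variable {p u} in
lemma history_congr (hn0 : 0 < n0) {u' : ℤ → p.Start → ℝ} (t : ℕ) (j : ℤ)
    (h : ∀ m, winStart n0 j ≤ m → m < winStart n0 j + t → ∀ a, u m a = u' m a) :
    p.history n0 u t j = p.history n0 u' t j := by
  induction t using Nat.strong_induction_on generalizing j with
  | _ t ih =>
  rcases t with _ | t
  · simp [history_zero]
  have ih1 := ih t (by omega) j fun m h1 h2 => h m h1 (by push_cast; omega)
  rw [history_succ, history_succ, ih1]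
  congr 1
  rcases lt_or_ge t n0 with ht | ht
  · rw [value_of_lt _ _ _ ht, value_of_lt _ _ _ ht]
    exact coalesced_congr _ _ _ fun m h1 h2 => h m h1 (by push_cast; omega)
  · obtain ⟨k, i, hi, rfl⟩ : ∃ k i, i < n0 ∧ t = n0 * (k + 1) + i := by
      refine ⟨t / n0 - 1, t % n0, Nat.mod_lt _ hn0, ?_⟩
      have := Nat.div_pos ht hn0
      rw [Nat.sub_add_cancel this, Nat.div_add_mod]
    have hw : winStart n0 (j + 1) = winStart n0 j + n0 := by rw [winStart_add]; ring
    have hw' : winStart n0 (j + k + 1) = winStart n0 j + n0 * (k + 1) := by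
      rw [add_assoc, winStart_add]
    push_cast at h
    have e : n0 * (k + 1) = n0 * k + n0 := by ring
    have e' : (n0 : ℤ) * (k + 1) = n0 * k + n0 := by ring
    have ihold : ∀ s ≤ n0 * k + i + 1,
        p.history n0 u s (j + 1) = p.history n0 u' s (j + 1) := fun s hs =>
      ih s (by omega) _ fun m h1 h2 => h m (by omega) (by zify at hs; omega)
    have ihcur : p.history n0 u (n0 * (k + 1)) j = p.history n0 u' (n0 * (k + 1)) j :=
      ih _ (by omega) _ fun m h1 h2 => h m h1 (by push_cast at h2; omega)
    have hval : p.value n0 u (n0 * k + i) (j + 1) = p.value n0 u' (n0 * k + i) (j + 1) := by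
      unfold value; rw [ihold _ le_rfl]
    have htraj : ∀ s ≤ i + 1, ∀ b, p.startTraj u (winStart n0 (j + k + 1)) b s =
        p.startTraj u' (winStart n0 (j + k + 1)) b s := fun s hs b =>
      startTraj_congr _ _ fun m h1 h2 => h m (by
        have : (0 : ℤ) ≤ n0 * k := by positivity
        omega) (by omega) b
    have hu : ∀ b, u (winStart n0 (j + k + 1) + i) b = u' (winStart n0 (j + k + 1) + i) b :=
      h _ (by
        have : (0 : ℤ) ≤ n0 * k := by positivity
        omega) (by omega)
    rw [value_window _ _ _ hi, value_window _ _ _ hi]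
    simp only [hval, ih1, ihcur, ihold _ (show n0 * k ≤ n0 * k + i + 1 by omega),
      ihold _ (show n0 * k + i ≤ n0 * k + i + 1 by omega), htraj _ le_rfl,
      htraj _ (Nat.le_succ i), hu]

/-- The family of numbers seen from the time `s`. -/
def timeShift {S : Type*} (s : ℤ) (u : ℤ → S → ℝ) : ℤ → S → ℝ := fun m a => u (m + s) a

lemma startTraj_timeShift (s l : ℤ) (a : p.Start) (t : ℕ) :
    p.startTraj (timeShift s u) l a t = p.startTraj u (l + s) a t :=
  traj_congr p _ fun i _ => by simp only [timeShift]; congr 1; ring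

lemma coalesced_timeShift (s l : ℤ) (t : ℕ) :
    p.coalesced (timeShift s u) l t = p.coalesced u (l + s) t := by
  unfold coalesced
  simp only [startTraj_timeShift]

lemma history_timeShift (hn0 : 0 < n0) (s : ℤ) (t : ℕ) (j : ℤ) :
    p.history n0 (timeShift (n0 * s) u) t j = p.history n0 u t (j + s) := by
  induction t using Nat.strong_induction_on generalizing j with
  | _ t ih =>
  rcases t with _ | t
  · simp [history_zero]
  have ih1 := ih t (by omega) j
  rw [history_succ, history_succ, ih1]
  congr 1
  rcases lt_or_ge t n0 with ht | ht
  · rw [value_of_lt _ _ _ ht, value_of_lt _ _ _ ht, coalesced_timeShift, winStart_add]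
  · obtain ⟨k, i, hi, rfl⟩ : ∃ k i, i < n0 ∧ t = n0 * (k + 1) + i := by
      refine ⟨t / n0 - 1, t % n0, Nat.mod_lt _ hn0, ?_⟩
      have := Nat.div_pos ht hn0
      rw [Nat.sub_add_cancel this, Nat.div_add_mod]
    have e : n0 * (k + 1) = n0 * k + n0 := by ring
    have ihold : ∀ r ≤ n0 * k + i + 1, p.history n0 (timeShift (n0 * s) u) r (j + 1) =
        p.history n0 u r (j + s + 1) := fun r hr => by
      rw [ih r (by omega), add_right_comm]
    have ihcur := ih (n0 * (k + 1)) (by omega) j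
    have hval : p.value n0 (timeShift (n0 * s) u) (n0 * k + i) (j + 1) =
        p.value n0 u (n0 * k + i) (j + s + 1) := by
      unfold value; rw [ihold _ le_rfl]
    have hw : winStart n0 (j + s + k + 1) = winStart n0 (j + k + 1) + n0 * s := by
      rw [← winStart_add]; ring_nf
    have hu : ∀ b, timeShift (n0 * s) u (winStart n0 (j + k + 1) + i) b =
        u (winStart n0 (j + s + k + 1) + i) b := fun b => by
      simp only [timeShift, hw]; congr 1; ring
    rw [value_window _ _ _ hi, value_window _ _ _ hi]
    simp only [hval, ih1, ihcur, ihold _ (show n0 * k ≤ n0 * k + i + 1 by omega),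
      ihold _ (show n0 * k + i ≤ n0 * k + i + 1 by omega), startTraj_timeShift, hu, hw]

end History

/-! ### The conditional law of the next value. -/

section Law

variable {p : ProbKernel A} {n0 : ℕ} {u : ℤ → p.Start → ℝ}

lemma exists_window (hn0 : 0 < n0) (t : ℕ) : ∃ k i, i < n0 ∧ t = n0 * k + i :=
  ⟨t / n0, t % n0, Nat.mod_lt _ hn0, (Nat.div_add_mod _ _).symm⟩

/-- A value known at stage `j + 1` is never changed at stage `j`, so adding an earlier window only
adds information. -/
lemma refines_history_succ (hn0 : 0 < n0) (t : ℕ) (j : ℤ) :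
    Refines (p.history n0 u (n0 + t) j) (p.history n0 u t (j + 1)) := by
  induction t with
  | zero => rw [history_zero]; exact Refines.nil _
  | succ t ih =>
    rw [← add_assoc, history_succ, history_succ]
    refine Refines.cons (fun h => ?_) ih
    obtain ⟨k, i, hi, rfl⟩ := exists_window hn0 t
    have e : n0 + (n0 * k + i) = n0 * (k + 1) + i := by ring
    rw [e, value_window _ _ _ hi, if_pos h]

lemma start_eq_of_refines {w w' : List (WithTop A)} (hr : Refines w w') {b b' : p.Start}
    (h : w.take p.nHat = str b.1) (h' : w'.take p.nHat = str b'.1) : b = b' := by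
  apply Subtype.ext
  apply str_injective
  rw [← h, take_eq_str_of_refines (hr.trans (refines_str_of_take_eq h'))]

/-- If stage `j` knows no start before the window, neither does any later stage, by refinement. No
update ever occurs, and the value is inherited from the stage that begins with this very window. -/
lemma value_eq_coalesced (hn0 : 0 < n0) {i : ℕ} (hi : i < n0) (k : ℕ) (j : ℤ)
    (h : ∀ b : p.Start, (p.history n0 u (n0 * k) j).take p.nHat ≠ str b.1) :
    p.value n0 u (n0 * k + i) j = p.coalesced u (winStart n0 (j + k)) i := by
  induction k generalizing j with
  | zero => simpa using value_of_lt p n0 u hi j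
  | succ k ih =>
    have h' : ∀ b : p.Start, (p.history n0 u (n0 * k) (j + 1)).take p.nHat ≠ str b.1 := by
      intro b hb
      refine h b (take_eq_str_of_refines (Refines.trans ?_ (refines_str_of_take_eq hb)))
      rw [mul_add, mul_one, add_comm]
      exact refines_history_succ hn0 _ _
    have hw : j + ((k + 1 : ℕ) : ℤ) = j + 1 + k := by push_cast; ring
    rw [value_window _ _ _ hi, dif_neg (by push Not; exact h), hw, ← ih _ h']
    split_ifs with h1
    · rfl
    · simp only [ne_eq, not_not] at h1; exact h1.symm

/-- The value when the preceding values form `b ∈ C`, and this was not known to the next stage. -/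
lemma value_of_new (hn0 : 0 < n0) {i : ℕ} (hi : i < n0) (k : ℕ) (j : ℤ) {b : p.Start}
    (hb : (p.history n0 u (n0 * (k + 1)) j).take p.nHat = str b.1)
    (hold : (p.history n0 u (n0 * k) (j + 1)).take p.nHat ≠ str b.1) :
    p.value n0 u (n0 * (k + 1) + i) j =
      if (p.startTraj u (winStart n0 (j + k + 1)) b (i + 1)).headD ⊤ ≠ ⊤ then
        (p.startTraj u (winStart n0 (j + k + 1)) b (i + 1)).headD ⊤
      else p.redraw (u (winStart n0 (j + k + 1) + i) b)
        (p.history n0 u (n0 * (k + 1) + i) j)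
        (p.startTraj u (winStart n0 (j + k + 1)) b i ++ str b.1) := by
  have hold' : ∀ b' : p.Start, (p.history n0 u (n0 * k) (j + 1)).take p.nHat ≠ str b'.1 := by
    intro b' hb'
    have hr := refines_history_succ (p := p) (u := u) hn0 (n0 * k) j
    rw [show n0 + n0 * k = n0 * (k + 1) by ring] at hr
    rw [← start_eq_of_refines hr hb hb'] at hb'
    exact hold hb'
  have hex : ∃ b : p.Start, (p.history n0 u (n0 * (k + 1)) j).take p.nHat = str b.1 := ⟨b, hb⟩
  have hch : hex.choose = b := start_eq_of_refines (Refines.refl _) hex.choose_spec hb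
  have hval := value_eq_coalesced hn0 hi k (j + 1) hold'
  rw [show j + 1 + (k : ℤ) = j + k + 1 by ring] at hval
  rw [value_window _ _ _ hi, dif_pos hex, hch, if_neg hold, hval]
  -- A coalesced value is shared by all trajectories, in particular by the one from `b`; keeping it
  -- therefore agrees with using that trajectory.
  by_cases hc : p.coalesced u (winStart n0 (j + k + 1)) i = ⊤
  · rw [if_neg (not_not.2 hc)]
  · rw [if_pos hc, headD_startTraj_of_coalesced hc b, if_pos hc]

lemma value_of_old {i : ℕ} (hi : i < n0) (k : ℕ) (j : ℤ) {b : p.Start}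
    (hb : (p.history n0 u (n0 * (k + 1)) j).take p.nHat = str b.1)
    (hold : (p.history n0 u (n0 * k) (j + 1)).take p.nHat = str b.1) :
    p.value n0 u (n0 * (k + 1) + i) j =
      if p.value n0 u (n0 * k + i) (j + 1) ≠ ⊤ then p.value n0 u (n0 * k + i) (j + 1)
      else p.redraw (u (winStart n0 (j + k + 1) + i) b)
        (p.history n0 u (n0 * (k + 1) + i) j) (p.history n0 u (n0 * k + i) (j + 1)) := by
  have hex : ∃ b : p.Start, (p.history n0 u (n0 * (k + 1)) j).take p.nHat = str b.1 := ⟨b, hb⟩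
  have hch : hex.choose = b := start_eq_of_refines (Refines.refl _) hex.choose_spec hb
  rw [value_window _ _ _ hi, dif_pos hex, hch, if_pos hold]

/-- Known draws of the trajectory from `b` are kept, so the history is finer than that trajectory,
as `HasLaw.redraw` requires. -/
lemma refines_startTraj (hn0 : 0 < n0) (k : ℕ) (j : ℤ) {b : p.Start}
    (hb : (p.history n0 u (n0 * (k + 1)) j).take p.nHat = str b.1)
    (hold : (p.history n0 u (n0 * k) (j + 1)).take p.nHat ≠ str b.1) {i : ℕ} (hi : i ≤ n0) :
    Refines (p.history n0 u (n0 * (k + 1) + i) j)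
      (p.startTraj u (winStart n0 (j + k + 1)) b i ++ str b.1) := by
  induction i with
  | zero => exact refines_str_of_take_eq hb
  | succ i ih =>
    rw [← add_assoc, history_succ, startTraj_succ, List.cons_append]
    refine Refines.cons (fun h => ?_) (ih (by omega))
    rw [value_of_new hn0 (by omega) k j hb hold, startTraj_succ, List.headD_cons, if_pos h]

/-- If the values of `X^{(j)}` before a window form `b ∈ C`, then the law of the next value given
the past is the one prescribed by `α` at the string of all the values of `X^{(j)}`. -/
lemma exists_hasLaw_value (hn0 : 0 < n0) (hn : 1 ≤ p.nHat) {i : ℕ} (hi : i < n0) (k : ℕ) (j : ℤ)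
    {b : p.Start} (hb : (p.history n0 u (n0 * (k + 1)) j).take p.nHat = str b.1)
    (hc : p.Consistent (p.history n0 u (n0 * (k + 1) + i) j)) :
    ∃ Y, p.HasLaw Y (p.history n0 u (n0 * (k + 1) + i) j) ∧
      ∀ u' : ℤ → p.Start → ℝ, (∀ m < winStart n0 (j + k + 1) + i, ∀ a, u m a = u' m a) →
        p.value n0 u' (n0 * (k + 1) + i) j = Y (u' (winStart n0 (j + k + 1) + i) b) := by
  induction k using Nat.strong_induction_on generalizing j with
  | _ k ih =>
  have hhist : ∀ u' : ℤ → p.Start → ℝ,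
      (∀ m < winStart n0 (j + k + 1) + i, ∀ a, u m a = u' m a) →
      ∀ t ≤ n0 * (k + 1) + i, p.history n0 u' t j = p.history n0 u t j ∧
        ∀ s ≤ n0 * k + i, p.history n0 u' s (j + 1) = p.history n0 u s (j + 1) := by
    intro u' hu' t ht
    have hw' : winStart n0 (j + k + 1) = winStart n0 j + n0 * (k + 1) := by
      rw [add_assoc, winStart_add]
    have hw : winStart n0 (j + 1) = winStart n0 j + n0 := by rw [winStart_add]; ring
    refine ⟨(history_congr n0 hn0 t j fun m _ h2 => hu' m ?_).symm, fun s hs =>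
      (history_congr n0 hn0 s (j + 1) fun m _ h2 => hu' m ?_).symm⟩
    · zify at ht
      linarith
    · zify at hs
      linarith
  -- If stage `j + 1` already knew the start `b`, induction gives the law of its value and one
  -- redraw refines it. Otherwise the law begins with a plain draw from the trajectory of `b`. Both
  -- cases use the same number `u^b`.
  by_cases hold : (p.history n0 u (n0 * k) (j + 1)).take p.nHat = str b.1
  · rcases k with _ | k
    -- For `k = 0` stage `j + 1` has no earlier values, and the empty string is not a start since
    -- `n̂ ≥ 1`.
    · rw [mul_zero, history_zero] at hold
      have := congrArg List.length hold
      simp [length_str] at this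
      omega
    have hr : Refines (p.history n0 u (n0 * (k + 1 + 1) + i) j)
        (p.history n0 u (n0 * (k + 1) + i) (j + 1)) := by
      rw [show n0 * (k + 1 + 1) + i = n0 + (n0 * (k + 1) + i) by ring]
      exact refines_history_succ hn0 _ _
    obtain ⟨Y, hY, hval⟩ := ih k (by omega) (j + 1) hold (hc.mono hr)
    have hw : j + ((k + 1 : ℕ) : ℤ) + 1 = j + 1 + k + 1 := by push_cast; ring
    refine ⟨_, hY.redraw hc hr, fun u' hu' => ?_⟩
    obtain ⟨h1, h2⟩ := hhist u' hu' _ le_rfl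
    obtain ⟨h3, -⟩ := hhist u' hu' (n0 * (k + 1 + 1)) (by omega)
    rw [value_of_old hi (k + 1) j (h3 ▸ hb) ((h2 (n0 * (k + 1)) (by omega)).symm ▸ hold), h1,
      h2 _ le_rfl, hw, hval u' (by rwa [hw] at hu')]
  · refine ⟨_, (hasLaw_draw _).redraw hc (refines_startTraj hn0 k j hb hold hi.le),
      fun u' hu' => ?_⟩
    obtain ⟨h1, h2⟩ := hhist u' hu' _ le_rfl
    obtain ⟨h3, -⟩ := hhist u' hu' (n0 * (k + 1)) (by omega)
    have h4 : p.startTraj u' (winStart n0 (j + k + 1)) b i =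
        p.startTraj u (winStart n0 (j + k + 1)) b i :=
      startTraj_congr _ _ fun m _ hm => (hu' m hm b).symm
    rw [value_of_new hn0 hi k j (h3 ▸ hb) ((h2 (n0 * k) (by omega)).symm ▸ hold), h1,
      startTraj_succ, h4, List.headD_cons]

end Law

/-! ### Resampling and independence in product spaces. -/

section Product

variable {ι : Type*} (ν : ι → Measure ℝ) [∀ i, IsProbabilityMeasure (ν i)]

lemma map_update_infinitePi [DecidableEq ι] (i : ι) :
    ((Measure.infinitePi ν).prod (ν i)).map (fun q => Function.update q.1 i q.2) =
      Measure.infinitePi ν := by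
  have hm : Measurable (fun q : (ι → ℝ) × ℝ => Function.update q.1 i q.2) :=
    measurable_pi_iff.2 fun k => by
      by_cases hk : k = i
      · subst hk; simpa using measurable_snd
      · simp only [Function.update_of_ne hk]; fun_prop
  refine Measure.eq_infinitePi _ fun s t ht => ?_
  rw [Measure.map_apply hm (.pi s.countable_toSet fun k _ => ht k)]
  by_cases hi : i ∈ s
  · have : (fun q : (ι → ℝ) × ℝ => Function.update q.1 i q.2) ⁻¹' (Set.pi s t) =
        (Set.pi (s.erase i : Finset ι) t) ×ˢ (t i) := by
      ext q
      simp only [Set.mem_preimage, Set.mem_pi, Finset.mem_coe, Set.mem_prod, Finset.mem_erase]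
      constructor
      · intro h
        refine ⟨fun k hk => ?_, by simpa using h i hi⟩
        simpa [Function.update_of_ne hk.1] using h k hk.2
      · rintro ⟨h1, h2⟩ k hk
        by_cases hki : k = i
        · subst hki; simpa using h2
        · simpa [Function.update_of_ne hki] using h1 k ⟨hki, hk⟩
    rw [this, Measure.prod_prod, Measure.infinitePi_pi _ fun k _ => ht k,
      Finset.prod_erase_mul _ _ hi]
  · have : (fun q : (ι → ℝ) × ℝ => Function.update q.1 i q.2) ⁻¹' (Set.pi s t) =
        (Set.pi s t) ×ˢ Set.univ := by
      ext q
      simp only [Set.mem_preimage, Set.mem_pi, Finset.mem_coe, Set.mem_prod, Set.mem_univ,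
        and_true]
      refine forall₂_congr fun k hk => ?_
      rw [Function.update_of_ne (by rintro rfl; exact hi hk)]
    rw [this, Measure.prod_prod, Measure.infinitePi_pi _ fun k _ => ht k, measure_univ, mul_one]

/-- A lower bound on a conditional probability without conditioning: resampling coordinate `i`
preserves the product law and does not affect `E`, so Fubini applies. -/
lemma mul_measure_le_of_update [DecidableEq ι] (i : ι) {E G : Set (ι → ℝ)} (hE : MeasurableSet E)
    (hG : MeasurableSet G) (hEi : ∀ u v, Function.update u i v ∈ E ↔ u ∈ E) {r : ENNReal}
    (h : ∀ᵐ u ∂Measure.infinitePi ν, u ∈ E → r ≤ ν i {v | Function.update u i v ∈ G}) :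
    r * Measure.infinitePi ν E ≤ Measure.infinitePi ν (E ∩ G) := by
  have hm : Measurable (fun q : (ι → ℝ) × ℝ => Function.update q.1 i q.2) :=
    measurable_pi_iff.2 fun k => by
      by_cases hk : k = i
      · subst hk; simpa using measurable_snd
      · simp only [Function.update_of_ne hk]; fun_prop
  conv_rhs => rw [← map_update_infinitePi ν i, Measure.map_apply hm (hE.inter hG),
    Measure.prod_apply (hm (hE.inter hG))]
  rw [← lintegral_indicator_const hE]
  refine lintegral_mono_ae ?_
  filter_upwards [h] with u hu
  by_cases huE : u ∈ E
  · rw [Set.indicator_of_mem huE]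
    refine (hu huE).trans (measure_mono fun v hv => ?_)
    exact ⟨(hEi u v).2 huE, hv⟩
  · rw [Set.indicator_of_notMem huE]
    exact zero_le

/-- The set `E` depends only on the coordinates in `S`. -/
def DependsOnly (E : Set (ι → ℝ)) (S : Set ι) : Prop :=
  ∀ u u' : ι → ℝ, (∀ i ∈ S, u i = u' i) → (u ∈ E ↔ u' ∈ E)

/-- The map that sets all coordinates outside `S` to `0` is measurable for the smaller σ-algebra,
and `E` is its own preimage under it. -/
lemma measurableSet_iSup_of_dependsOnly {E : Set (ι → ℝ)} {S : Set ι} (hE : MeasurableSet E)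
    (h : DependsOnly E S) :
    MeasurableSet[⨆ i ∈ S, MeasurableSpace.comap (fun u : ι → ℝ => u i) inferInstance] E := by
  let f : (ι → ℝ) → (ι → ℝ) := fun u i => if i ∈ S then u i else 0
  have hf : Measurable[⨆ i ∈ S, MeasurableSpace.comap (fun u : ι → ℝ => u i) inferInstance] f := by
    refine (@measurable_pi_iff _ _ _ (_) _ _).2 fun i => ?_
    by_cases hi : i ∈ S
    · simp only [f, if_pos hi]
      exact Measurable.mono (comap_measurable _)
        (le_iSup₂ (f := fun (i : ι) (_ : i ∈ S) =>
          MeasurableSpace.comap (fun u : ι → ℝ => u i) inferInstance) i hi) le_rfl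
    · simp only [f, if_neg hi]
      exact @measurable_const _ _ _ (_) _
  have : E = f ⁻¹' E := by
    ext u
    exact h u (f u) fun i hi => by simp [f, hi]
  rw [this]
  exact hf hE

lemma measure_inter_of_dependsOnly {E F : Set (ι → ℝ)} {S T : Set ι} (hE : MeasurableSet E)
    (hF : MeasurableSet F) (hES : DependsOnly E S) (hFT : DependsOnly F T) (hST : Disjoint S T) :
    Measure.infinitePi ν (E ∩ F) = Measure.infinitePi ν E * Measure.infinitePi ν F := by
  have h1 : iIndepFun (fun (i : ι) (u : ι → ℝ) => u i) (Measure.infinitePi ν) :=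
    iIndepFun_infinitePi (X := fun _ x => x) fun _ => measurable_id
  have h2 := indep_iSup_of_disjoint (fun i => (measurable_pi_apply i).comap_le) h1 hST
  exact Indep_iff _ _ _ |>.1 h2 E F (measurableSet_iSup_of_dependsOnly hE hES)
    (measurableSet_iSup_of_dependsOnly hF hFT)

end Product

/-! ### Measurability of the algorithm, through level sets of countably valued maps. -/

section DiscreteMeasurable

variable {Ω β γ : Type*} [MeasurableSpace Ω]

lemma measurableSet_setOf_forall {κ : Sort*} [Countable κ] {P : κ → Ω → Prop}
    (h : ∀ i, MeasurableSet {ω | P i ω}) : MeasurableSet {ω | ∀ i, P i ω} := by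
  have : {ω | ∀ i, P i ω} = ⋂ i, {ω | P i ω} := by ext; simp
  rw [this]
  exact .iInter h

/-- All the level sets of `f` are measurable. -/
def LevelMeasurable (f : Ω → β) : Prop := ∀ b, MeasurableSet {ω | f ω = b}

lemma LevelMeasurable.const (b : β) : LevelMeasurable (fun _ : Ω => b) := fun _ => .const _

/-- Splitting over the countably many values of `f` lets a computation be checked with one
ingredient frozen at a time. -/
lemma LevelMeasurable.bind [Countable β] {f : Ω → β} (hf : LevelMeasurable f) {F : β → Ω → γ}
    (hF : ∀ b, LevelMeasurable (F b)) : LevelMeasurable (fun ω => F (f ω) ω) := by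
  intro c
  have : {ω | F (f ω) ω = c} = ⋃ b, ({ω | f ω = b} ∩ {ω | F b ω = c}) := by
    ext ω; simp
  rw [this]
  exact .iUnion fun b => (hf b).inter (hF b c)

lemma LevelMeasurable.measurableSet [Countable β] {f : Ω → β} (hf : LevelMeasurable f)
    (P : β → Prop) : MeasurableSet {ω | P (f ω)} := by
  have : {ω | P (f ω)} = ⋃ b, ⋃ (_ : P b), {ω | f ω = b} := by
    ext ω; simp
  rw [this]
  exact .iUnion fun b => .iUnion fun _ => hf b

end DiscreteMeasurable

instance : Countable (WithTop A) := inferInstanceAs (Countable (Option A))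

lemma levelMeasurable_firstBelow {Ω : Type*} [MeasurableSpace Ω] {x : Ω → ℝ} (hx : Measurable x)
    (F : A → ℝ) : LevelMeasurable (fun ω => firstBelow (x ω) F) := by
  intro b
  induction b using WithTop.recTopCoe with
  | top =>
    simp only [firstBelow_eq_top_iff]
    exact measurableSet_setOf_forall fun g => measurableSet_le measurable_const hx
  | coe g =>
    simp only [firstBelow_eq_coe_iff]
    exact (measurableSet_lt hx measurable_const).inter
      (measurableSet_setOf_forall fun g' => measurableSet_setOf_forall fun _ =>
        measurableSet_le measurable_const hx)

section Measurability

variable {p : ProbKernel A} {Ω : Type*} [MeasurableSpace Ω]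

lemma levelMeasurable_traj {v : ℕ → Ω → ℝ} (hv : ∀ i, Measurable (v i)) (a : List (WithTop A))
    (t : ℕ) : LevelMeasurable (fun ω => p.traj (fun i => v i ω) a t) := by
  induction t with
  | zero => exact LevelMeasurable.const _
  | succ t ih =>
    refine ih.bind (F := fun w ω => p.draw (v t ω) (w ++ a) :: w) fun w => ?_
    exact (levelMeasurable_firstBelow (hv t) _).bind (F := fun x _ => x :: w)
      fun x => LevelMeasurable.const _

/-- The value at a time of a later window, as a function of the data it is computed from. -/
noncomputable def windowValue (r : p.Start → ℝ) (x' x : p.Start → List (WithTop A))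
    (old cur oldStart curStart : List (WithTop A)) (v : WithTop A) : WithTop A :=
  if v ≠ ⊤ then v
  else if hb : ∃ b : p.Start, curStart.take p.nHat = str b.1 then
    if oldStart.take p.nHat = str hb.choose.1 then p.redraw (r hb.choose) cur old
    else
      if (x hb.choose).headD ⊤ ≠ ⊤ then (x hb.choose).headD ⊤
      else p.redraw (r hb.choose) cur (x' hb.choose ++ str hb.choose.1)
  else ⊤

variable {U : ℤ → p.Start → Ω → ℝ} (hU : ∀ m a, Measurable (U m a))
include hU

lemma levelMeasurable_startTraj (l : ℤ) (a : p.Start) (t : ℕ) :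
    LevelMeasurable (fun ω => p.startTraj (fun m a => U m a ω) l a t) :=
  levelMeasurable_traj (v := fun i => U (l + i) a) (fun _ => hU _ _) _ _

lemma measurableSet_forall_startTraj (l : ℤ) (t : ℕ) (P : List (WithTop A) → Prop) :
    MeasurableSet {ω | ∀ a, P (p.startTraj (fun m a => U m a ω) l a t)} :=
  measurableSet_setOf_forall fun a => (levelMeasurable_startTraj hU l a t).measurableSet P

lemma levelMeasurable_startTraj_pi (l : ℤ) (t : ℕ) :
    LevelMeasurable (fun ω (a : p.Start) => p.startTraj (fun m a => U m a ω) l a t) := by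
  intro f
  simp only [funext_iff]
  exact measurableSet_setOf_forall fun a => levelMeasurable_startTraj hU l a t (f a)

lemma levelMeasurable_coalesced (l : ℤ) (t : ℕ) :
    LevelMeasurable (fun ω => p.coalesced (fun m a => U m a ω) l t) := by
  exact (levelMeasurable_startTraj_pi hU l (t + 1)).bind (F := fun f _ =>
    if h : ∃ g : A, ∀ a : p.Start, (f a).headD ⊤ = (g : WithTop A) then
      (h.choose : WithTop A) else ⊤) fun f => LevelMeasurable.const _

lemma levelMeasurable_value_history {n0 : ℕ} (hn0 : 0 < n0) (t : ℕ) (j : ℤ) :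
    LevelMeasurable (fun ω => p.value n0 (fun m a => U m a ω) t j) ∧
      LevelMeasurable (fun ω => p.history n0 (fun m a => U m a ω) t j) := by
  induction t using Nat.strong_induction_on generalizing j with
  | _ t ih =>
  have hh : LevelMeasurable (fun ω => p.history n0 (fun m a => U m a ω) t j) := by
    rcases t with _ | t
    · simp only [history_zero]; exact LevelMeasurable.const _
    · simp only [history_succ]
      obtain ⟨h1, h2⟩ := ih t (by omega) j
      refine h1.bind (F := fun x ω => x :: p.history n0 (fun m a => U m a ω) t j) fun x => ?_
      exact h2.bind (F := fun w _ => x :: w) fun w => LevelMeasurable.const _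
  refine ⟨?_, hh⟩
  rcases lt_or_ge t n0 with ht | ht
  · simp only [value_of_lt _ _ _ ht]
    exact levelMeasurable_coalesced hU _ _
  obtain ⟨k, i, hi, rfl⟩ : ∃ k i, i < n0 ∧ t = n0 * (k + 1) + i := by
    refine ⟨t / n0 - 1, t % n0, Nat.mod_lt _ hn0, ?_⟩
    have := Nat.div_pos ht hn0
    rw [Nat.sub_add_cancel this, Nat.div_add_mod]
  have e : n0 * (k + 1) = n0 * k + n0 := by ring
  simp only [value_window _ _ _ hi]
  have h1 := (ih (n0 * k + i) (by omega) (j + 1)).1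
  have h2 : LevelMeasurable (fun ω => p.history n0 (fun m a => U m a ω) (n0 * (k + 1)) j) := by
    rcases Nat.eq_zero_or_pos i with rfl | hi'
    · exact hh
    · exact (ih _ (by omega) j).2
  have h3 := (ih (n0 * k) (by omega) (j + 1)).2
  have h4 := (ih (n0 * k + i) (by omega) (j + 1)).2
  have h5 := levelMeasurable_startTraj_pi hU (winStart n0 (j + k + 1)) (i + 1)
  have h6 := levelMeasurable_startTraj_pi hU (winStart n0 (j + k + 1)) i
  -- The seven random strings and values are frozen one after another, until only the uniform number
  -- at the current time is random.
  refine h1.bind (F := fun x ω => windowValue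
    (fun b => U (winStart n0 (j + k + 1) + i) b ω)
    (fun b => p.startTraj (fun m a => U m a ω) (winStart n0 (j + k + 1)) b i)
    (fun b => p.startTraj (fun m a => U m a ω) (winStart n0 (j + k + 1)) b (i + 1))
    (p.history n0 (fun m a => U m a ω) (n0 * k + i) (j + 1))
    (p.history n0 (fun m a => U m a ω) (n0 * (k + 1) + i) j)
    (p.history n0 (fun m a => U m a ω) (n0 * k) (j + 1))
    (p.history n0 (fun m a => U m a ω) (n0 * (k + 1)) j) x) fun x => ?_
  refine h2.bind (F := fun x2 ω => windowValue
    (fun b => U (winStart n0 (j + k + 1) + i) b ω)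
    (fun b => p.startTraj (fun m a => U m a ω) (winStart n0 (j + k + 1)) b i)
    (fun b => p.startTraj (fun m a => U m a ω) (winStart n0 (j + k + 1)) b (i + 1))
    (p.history n0 (fun m a => U m a ω) (n0 * k + i) (j + 1))
    (p.history n0 (fun m a => U m a ω) (n0 * (k + 1) + i) j)
    (p.history n0 (fun m a => U m a ω) (n0 * k) (j + 1)) x2 x) fun x2 => ?_
  refine h3.bind (F := fun x3 ω => windowValue
    (fun b => U (winStart n0 (j + k + 1) + i) b ω)
    (fun b => p.startTraj (fun m a => U m a ω) (winStart n0 (j + k + 1)) b i)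
    (fun b => p.startTraj (fun m a => U m a ω) (winStart n0 (j + k + 1)) b (i + 1))
    (p.history n0 (fun m a => U m a ω) (n0 * k + i) (j + 1))
    (p.history n0 (fun m a => U m a ω) (n0 * (k + 1) + i) j) x3 x2 x) fun x3 => ?_
  refine hh.bind (F := fun x4 ω => windowValue
    (fun b => U (winStart n0 (j + k + 1) + i) b ω)
    (fun b => p.startTraj (fun m a => U m a ω) (winStart n0 (j + k + 1)) b i)
    (fun b => p.startTraj (fun m a => U m a ω) (winStart n0 (j + k + 1)) b (i + 1))
    (p.history n0 (fun m a => U m a ω) (n0 * k + i) (j + 1)) x4 x3 x2 x) fun x4 => ?_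
  refine h4.bind (F := fun x5 ω => windowValue
    (fun b => U (winStart n0 (j + k + 1) + i) b ω)
    (fun b => p.startTraj (fun m a => U m a ω) (winStart n0 (j + k + 1)) b i)
    (fun b => p.startTraj (fun m a => U m a ω) (winStart n0 (j + k + 1)) b (i + 1))
    x5 x4 x3 x2 x) fun x5 => ?_
  refine h5.bind (F := fun x6 ω => windowValue
    (fun b => U (winStart n0 (j + k + 1) + i) b ω)
    (fun b => p.startTraj (fun m a => U m a ω) (winStart n0 (j + k + 1)) b i)
    x6 x5 x4 x3 x2 x) fun x6 => ?_
  refine h6.bind (F := fun x7 ω => windowValue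
    (fun b => U (winStart n0 (j + k + 1) + i) b ω) x7 x6 x5 x4 x3 x2 x) fun x7 => ?_
  unfold windowValue
  split_ifs
  all_goals first
    | exact LevelMeasurable.const _
    | exact levelMeasurable_firstBelow (A := A) (hU _ _) _

end Measurability

lemma exists_admissible_fits {p : ProbKernel A} {n : ℕ} (a : p.Past n) : ∃ h ∈ p.admissible, Fits h (str a.1) := by
  obtain ⟨w, h, hh, hf⟩ := a
  refine ⟨h, hh, fun k c hk => ?_⟩
  obtain ⟨hk', hc⟩ := (str_getElem? _ _ _).1 hk
  rw [← hc]
  exact hf ⟨k, hk'⟩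

/-! ### Words followed after coalescence. -/

section Path

/-- All the trajectories started at `l_j` end with the string `x` in the window `I_j`. -/
def Coalesces (p : ProbKernel A) (n0 : ℕ) (x : p.Start) (j : ℤ) (v : ℤ → p.Start → ℝ) : Prop :=
  ∀ a, (p.startTraj v (winStart n0 j) a n0).take p.nHat = str x.1

/-- The trajectories coalesce to `x` in the window `I_j`, and the string of the next values of
`X^{(j)}` is the given one. -/
def FollowsPath (p : ProbKernel A) (n0 : ℕ) (x : p.Start) (j : ℤ) (v : ℤ → p.Start → ℝ) :
    List A → Prop
  | [] => Coalesces p n0 x j v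
  | g :: a => FollowsPath p n0 x j v a ∧ p.value n0 v (n0 + a.length) j = g

/-- The trajectories coalesce to `x` in the window `I_j`, and the next `n` values of `X^{(j)}` are
known. -/
def Survives (p : ProbKernel A) (n0 : ℕ) (x : p.Start) (j : ℤ) (n : ℕ) (v : ℤ → p.Start → ℝ) :
    Prop :=
  Coalesces p n0 x j v ∧ ∀ s < n, p.value n0 v (n0 + s) j ≠ ⊤

variable {p : ProbKernel A} {n0 : ℕ} {x : p.Start} {j : ℤ} {v : ℤ → p.Start → ℝ}

lemma FollowsPath.coalesces {a : List A} (h : FollowsPath p n0 x j v a) :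
    Coalesces p n0 x j v := by
  induction a with
  | nil => exact h
  | cons g a ih => exact ih h.1

lemma FollowsPath.survives {a : List A} (h : FollowsPath p n0 x j v a) :
    Survives p n0 x j a.length v := by
  refine ⟨h.coalesces, ?_⟩
  induction a with
  | nil => intro s hs; simp at hs
  | cons g a ih =>
    intro s hs
    rcases Nat.lt_succ_iff_lt_or_eq.1 hs with h1 | rfl
    · exact ih h.1 s h1
    · rw [h.2]; exact WithTop.coe_ne_top

lemma FollowsPath.history_eq {a : List A} (h : FollowsPath p n0 x j v a) :
    p.history n0 v (n0 + a.length) j = known a ++ p.history n0 v n0 j := by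
  induction a with
  | nil => rfl
  | cons g a ih =>
    rw [List.length_cons, ← add_assoc, history_succ, ih h.1, h.2]
    rfl

lemma known_injective : Function.Injective (known : List A → List (WithTop A)) :=
  List.map_injective_iff.2 fun _ _ h => WithTop.coe_injective h

lemma FollowsPath.eq {a a' : List A} (h : FollowsPath p n0 x j v a)
    (h' : FollowsPath p n0 x j v a') (hl : a.length = a'.length) : a = a' := by
  have h1 := h.history_eq
  rw [hl, h'.history_eq] at h1
  exact (known_injective (List.append_cancel_right h1)).symm

lemma drop_startTraj (v : ℤ → p.Start → ℝ) (l : ℤ) (a : p.Start) (t i : ℕ) :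
    (p.startTraj v l a (t + i)).drop i = p.startTraj v l a t := by
  induction i with
  | zero => rfl
  | succ i ih => rw [← add_assoc, startTraj_succ, List.drop_succ_cons, ih]

/-- At each of the last `n̂` times all trajectories show the same symbol, which is then the value of
`X^{(j)}`. -/
lemma Coalesces.refines (hn0 : p.nHat ≤ n0) (h : Coalesces p n0 x j v) :
    Refines (p.history n0 v n0 j) (str x.1) := by
  intro k c hc
  have hk : k < p.nHat := ((str_getElem? _ _ _).1 hc).1
  obtain ⟨t, ht⟩ : ∃ t, n0 = t + 1 + k := ⟨n0 - 1 - k, by omega⟩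
  have h1 : ∀ a, (p.startTraj v (winStart n0 j) a (t + 1)).headD ⊤ = (c : WithTop A) := by
    intro a
    have h2 : (p.startTraj v (winStart n0 j) a n0)[k]? = some (c : WithTop A) :=
      refines_str_of_take_eq (h a) k c hc
    have h3 := drop_startTraj v (winStart n0 j) a (t + 1) k
    rw [← ht] at h3
    rw [← h3, List.headD_eq_head?_getD, List.head?_drop, h2]
    rfl
  have h4 := drop_history p n0 v (t + 1) k j
  rw [← ht] at h4
  have h5 : (p.history n0 v n0 j)[k]? = (p.history n0 v (t + 1) j).head? := by
    rw [← h4, List.head?_drop]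
  rw [h5, history_succ, value_of_lt _ _ _ (by omega), coalesced_eq_coe x h1]
  rfl

/-- A drawn symbol has positive `α` and is therefore possible; an unknown draw may be filled with
any possible symbol. -/
lemma exists_fits_startTraj (hadd : p.Extendable) (hv : ∀ m a, 0 ≤ v m a) (l : ℤ) (a : p.Start)
    (t : ℕ) : ∃ h ∈ p.admissible, Fits h (p.startTraj v l a t ++ str a.1) := by
  induction t with
  | zero =>
    exact exists_admissible_fits a
  | succ t ih =>
    obtain ⟨h, hh, hf⟩ := ih
    rw [startTraj_succ, List.cons_append]
    by_cases hd : p.draw (v (l + t) a) (p.startTraj v l a t ++ str a.1) = ⊤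
    · obtain ⟨g, hg⟩ := Extendable.exists_prob_pos (p := p) h
      exact ⟨_, hadd h hh g hg, hf.cons (by simp [hd])⟩
    · obtain ⟨g, hg⟩ := WithTop.ne_top_iff_exists.1 hd
      have hpos := draw_pos (hv _ _) hg.symm
      refine ⟨_, hadd h hh g (hpos.trans_le (alpha_le hh hf g)), hf.cons fun c hc => ?_⟩
      rw [← hg] at hc
      exact WithTop.coe_injective hc

lemma startTraj_refines (a : p.Start) {t : ℕ} (ht : t ≤ n0) :
    Refines (p.startTraj v (winStart n0 j) a t) (p.history n0 v t j) := by
  induction t with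
  | zero => rw [history_zero]; exact Refines.nil _
  | succ t ih =>
    rw [startTraj_succ, history_succ]
    refine Refines.cons (fun h => ?_) (ih (by omega))
    rw [value_of_lt _ _ _ (by omega)] at h ⊢
    rw [← headD_startTraj_of_coalesced h a]
    rfl

/-- Inside `I_j` the stage `j` knows only what all trajectories share, hence no more than the single
trajectory from `x`. -/
lemma consistent_history_window (hadd : p.Extendable) (hv : ∀ m a, 0 ≤ v m a) (x : p.Start) :
    p.Consistent (p.history n0 v n0 j) := by
  obtain ⟨h, hh, hf⟩ := exists_fits_startTraj hadd hv (winStart n0 j) x n0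
  exact ⟨h, hh, hf.mono ((Refines.append_left _ _).trans (startTraj_refines x le_rfl))⟩

lemma alphaProd_drop_pos {a : List A} {w : List (WithTop A)} (h : 0 < p.alphaProd a w) (i : ℕ) :
    0 < p.alphaProd (a.drop i) w := by
  induction i generalizing a with
  | zero => exact h
  | succ i ih =>
    rcases a with _ | ⟨g, a⟩
    · exact h
    · exact ih (pos_of_alphaProd_cons_pos h).2

/-- On a path of positive weight, the last `n̂` values before each time form an element of `C`. -/
lemma FollowsPath.exists_start (hadd : p.Extendable) (hn0 : p.nHat ≤ n0) {a : List A}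
    (hpos : 0 < p.alphaProd a (str x.1)) (i : ℕ) :
    ∃ b : p.Start, ∀ v, FollowsPath p n0 x j v a →
      ((p.history n0 v (n0 + a.length) j).drop i).take p.nHat = str b.1 ∨ a.length < i := by
  -- Beyond the length of the word the choice of `b` is irrelevant.
  by_cases hi : a.length < i
  · exact ⟨x, fun v _ => Or.inr hi⟩
  obtain ⟨h, hh, hfx⟩ := exists_admissible_fits x
  obtain ⟨h1, h2⟩ := hadd.prepend_of_alphaProd_pos (Refines.refl _) hh hfx
    (alphaProd_drop_pos hpos i)
  set h' := prepend (a.drop i) h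
  -- The start is read off the word and `x` alone, so it is the same for all `v`: the next number
  -- used sits at a fixed coordinate.
  refine ⟨⟨fun r => h' r, h', h1, fun _ => rfl⟩, fun v hv => Or.inl ?_⟩
  apply take_eq_str_of_refines
  have e1 : (p.history n0 v (n0 + a.length) j).drop i =
      known (a.drop i) ++ p.history n0 v n0 j := by
    rw [hv.history_eq, List.drop_append_of_le_length (by simp [known]; omega)]
    simp [known, List.map_drop]
  rw [e1]
  refine (Refines.append (hv.coalesces.refines hn0)).trans ?_
  intro k c hk
  obtain ⟨hk', hc⟩ := (str_getElem? _ _ _).1 hk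
  have hknown : ∃ d : A, (known (a.drop i) ++ str x.1)[k]? = some (d : WithTop A) := by
    rw [List.getElem?_append]
    split_ifs with hlt
    · have : k < (a.drop i).length := by simpa [known] using hlt
      exact ⟨(a.drop i)[k], by simp [known]⟩
    · exact ⟨x.1 ⟨_, _⟩, (str_getElem? x.1 _ _).2 ⟨lt_of_le_of_lt (Nat.sub_le _ _) hk', rfl⟩⟩
  obtain ⟨d, hd⟩ := hknown
  rw [hd, ← hc, ← h2 k d hd]

end Path

/-! ### Lower bounds for survival by path weights. -/

section Measure

/-- The uniform distribution on `[0, 1)`. -/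
noncomputable def unitUniform : Measure ℝ := volume.restrict (Set.Ico 0 1)

instance : IsProbabilityMeasure unitUniform := ⟨by simp [unitUniform]⟩

/-- The law of the family of independent uniform variables. -/
noncomputable def driving (p : ProbKernel A) : Measure (ℤ × p.Start → ℝ) :=
  Measure.infinitePi fun _ => unitUniform

instance (p : ProbKernel A) : IsProbabilityMeasure p.driving := by
  unfold driving; infer_instance

/-- A point of the canonical space, as a family of numbers. -/
def numbers {S : Type*} (u : ℤ × S → ℝ) : ℤ → S → ℝ := fun m a => u (m, a)

variable {p : ProbKernel A} {n0 : ℕ}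

lemma measurable_numbers (m : ℤ) (a : p.Start) :
    Measurable (fun u : ℤ × p.Start → ℝ => numbers u m a) := measurable_pi_apply _

lemma numbers_update_of_ne {S : Type*} [DecidableEq (ℤ × S)] (u : ℤ × S → ℝ) (m : ℤ)
    (b : S) (r : ℝ) {m' : ℤ} (h : m' ≠ m) (a : S) :
    numbers (Function.update u (m, b) r) m' a = numbers u m' a := by
  unfold numbers
  rw [Function.update_of_ne (by simp [h])]

lemma ae_driving_mem (p : ProbKernel A) : ∀ᵐ u ∂p.driving, ∀ m a, 0 ≤ numbers u m a := by
  rw [ae_all_iff]; intro m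
  rw [ae_all_iff]; intro a
  have h := measurePreserving_eval_infinitePi (fun _ : ℤ × p.Start => unitUniform) (m, a)
  have h2 : ∀ᵐ r ∂unitUniform, 0 ≤ r := by
    unfold unitUniform
    filter_upwards [ae_restrict_mem measurableSet_Ico] with r hr using hr.1
  exact h.quasiMeasurePreserving.ae h2

lemma measurableSet_coalesces (x : p.Start) (j : ℤ) :
    MeasurableSet {u | Coalesces p n0 x j (numbers u)} :=
  measurableSet_forall_startTraj measurable_numbers _ _
    fun w => w.take p.nHat = str x.1

lemma measurableSet_value (hn0 : 0 < n0) (t : ℕ) (j : ℤ) (P : WithTop A → Prop) :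
    MeasurableSet {u | P (p.value n0 (numbers u) t j)} :=
  (levelMeasurable_value_history measurable_numbers hn0 t j).1.measurableSet P

lemma measurableSet_followsPath (hn0 : 0 < n0) (x : p.Start) (j : ℤ) (a : List A) :
    MeasurableSet {u | FollowsPath p n0 x j (numbers u) a} := by
  induction a with
  | nil => exact measurableSet_coalesces x j
  | cons g a ih => exact ih.inter (measurableSet_value hn0 _ j (· = (g : WithTop A)))

lemma measurableSet_survives (hn0 : 0 < n0) (x : p.Start) (j : ℤ) (n : ℕ) :
    MeasurableSet {u | Survives p n0 x j n (numbers u)} :=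
  (measurableSet_coalesces x j).inter <| measurableSet_setOf_forall fun _ =>
    measurableSet_setOf_forall fun _ => measurableSet_value hn0 _ j (· ≠ ⊤)

lemma Coalesces.congr {x : p.Start} {j : ℤ} {v v' : ℤ → p.Start → ℝ}
    (h : ∀ m, winStart n0 j ≤ m → m < winStart n0 j + n0 → ∀ a, v m a = v' m a) :
    Coalesces p n0 x j v ↔ Coalesces p n0 x j v' :=
  forall_congr' fun a => by rw [startTraj_congr _ a fun m h1 h2 => h m h1 h2 a]

lemma value_congr (hn0 : 0 < n0) {v v' : ℤ → p.Start → ℝ} (t : ℕ) (j : ℤ)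
    (h : ∀ m, winStart n0 j ≤ m → m ≤ winStart n0 j + t → ∀ a, v m a = v' m a) :
    p.value n0 v t j = p.value n0 v' t j := by
  unfold value
  rw [history_congr n0 hn0 (t + 1) j fun m h1 h2 => h m h1 (by push_cast at h2; omega)]

lemma FollowsPath.congr (hn0 : 0 < n0) {x : p.Start} {j : ℤ} {v v' : ℤ → p.Start → ℝ} (a : List A)
    (h : ∀ m, winStart n0 j ≤ m → m < winStart n0 j + n0 + a.length → ∀ a, v m a = v' m a) :
    FollowsPath p n0 x j v a ↔ FollowsPath p n0 x j v' a := by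
  induction a with
  | nil => exact Coalesces.congr fun m h1 h2 => h m h1 (by simpa using h2)
  | cons g a ih =>
    refine and_congr (ih fun m h1 h2 => h m h1 (by simp; omega)) ?_
    rw [value_congr hn0 _ _ fun m h1 h2 => h m h1 (by push_cast at h2; simp; omega)]

/-- One step of the path: given the path so far, the next value depends on a single number not used
before, and its law is at least `α` at the part of the history already guaranteed. -/
lemma alpha_mul_measure_followsPath_le (hadd : p.Extendable) (hn : 1 ≤ p.nHat)
    (hn0 : p.nHat ≤ n0) (x : p.Start) (j : ℤ) (g : A) {a : List A}
    (hpos : 0 < p.alphaProd a (str x.1)) :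
    ENNReal.ofReal (p.alpha g (known a ++ str x.1)) *
      p.driving {u | FollowsPath p n0 x j (numbers u) a} ≤
      p.driving {u | FollowsPath p n0 x j (numbers u) (g :: a)} := by
  have hn0' : 0 < n0 := by omega
  obtain ⟨k, i, hi, hk⟩ := exists_window hn0' a.length
  obtain ⟨b, hb⟩ := FollowsPath.exists_start (j := j) hadd hn0 hpos i
  have hlen : n0 + a.length = n0 * (k + 1) + i := by rw [hk]; ring
  have hwin : winStart n0 (j + k + 1) + i = winStart n0 j + n0 + a.length := by
    rw [add_assoc j, winStart_add, hk]; push_cast; ring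
  refine mul_measure_le_of_update (fun _ => unitUniform) (winStart n0 (j + k + 1) + i, b)
    (measurableSet_followsPath hn0' x j a)
    (measurableSet_value hn0' (n0 + a.length) j (· = (g : WithTop A))) (fun u r => ?_) ?_
  · refine FollowsPath.congr hn0' a fun m h1 h2 c => numbers_update_of_ne _ _ _ _ ?_ c
    omega
  filter_upwards [ae_driving_mem p] with u hu0 hu
  have hu : FollowsPath p n0 x j (numbers u) a := hu
  have hhist := hu.history_eq
  obtain ⟨h, hh, hf⟩ := consistent_history_window (n0 := n0) (j := j) hadd hu0 x
  have hcons : p.Consistent (known a ++ p.history n0 (numbers u) n0 j) := by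
    obtain ⟨h1, h2⟩ := hadd.prepend_of_alphaProd_pos (hu.coalesces.refines hn0) hh hf hpos
    exact ⟨_, h1, h2⟩
  have hb' : (p.history n0 (numbers u) (n0 * (k + 1)) j).take p.nHat = str b.1 := by
    rcases hb _ hu with hb | hb
    · rwa [hlen, drop_history] at hb
    · omega
  rw [hlen] at hhist
  obtain ⟨Y, hY, hval⟩ := exists_hasLaw_value hn0' hn hi k j hb' (hhist ▸ hcons)
  have hset : {r | Function.update u (winStart n0 (j + k + 1) + i, b) r ∈
      {u | p.value n0 (numbers u) (n0 + a.length) j = (g : WithTop A)}} = {r | Y r = g} := by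
    ext r
    have := hval (numbers (Function.update u (winStart n0 (j + k + 1) + i, b) r))
      (fun m hm c => (numbers_update_of_ne _ _ _ _ hm.ne c).symm)
    simp only [Set.mem_ofPred_eq, hlen, this]
    rw [numbers, Function.update_self]
  refine le_of_le_of_eq ?_ (congrArg unitUniform hset.symm)
  unfold unitUniform
  rw [Measure.restrict_apply' measurableSet_Ico]
  have h2 := hY.2 g
  have hset2 : {r | Y r = (g : WithTop A)} ∩ Set.Ico 0 1 =
      {v | v ∈ Set.Ico (0 : ℝ) 1 ∧ Y v = g} := by
    ext r; simp [and_comm]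
  rw [hset2, h2, hhist]
  -- The actual history may know symbols of `I_j` beyond `x`; this can only raise `α`.
  exact ENNReal.ofReal_le_ofReal
    (alpha_mono hcons (Refines.append (hu.coalesces.refines hn0)) g)

lemma alphaProd_mul_measure_coalesces_le (hadd : p.Extendable) (hn : 1 ≤ p.nHat)
    (hn0 : p.nHat ≤ n0) (x : p.Start) (j : ℤ) (a : List A) :
    ENNReal.ofReal (p.alphaProd a (str x.1)) * p.driving {u | Coalesces p n0 x j (numbers u)} ≤
      p.driving {u | FollowsPath p n0 x j (numbers u) a} := by
  induction a with
  | nil => simp [alphaProd, FollowsPath]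
  | cons g a ih =>
    rcases (p.alphaProd_nonneg a (str x.1)).eq_or_lt with h0 | hpos
    · simp [alphaProd_cons, ← h0]
    · refine le_trans ?_ (alpha_mul_measure_followsPath_le hadd hn hn0 x j g hpos)
      rw [alphaProd_cons, ENNReal.ofReal_mul (p.alpha_nonneg _ _), mul_assoc]
      gcongr

/-- The term of `ρ̃_n` that belongs to `x`. -/
noncomputable def rho (p : ProbKernel A) (x : p.Start) (n : ℕ) : ℝ :=
  ∑ a : Fin n → A, p.alphaProd (List.ofFn a) (str x.1)

/-- Distinct words of length `n` give disjoint events, each contained in survival, so the bounds for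
single words add up. -/
lemma rho_mul_measure_coalesces_le (hadd : p.Extendable) (hn : 1 ≤ p.nHat)
    (hn0 : p.nHat ≤ n0) (x : p.Start) (j : ℤ) (n : ℕ) :
    ENNReal.ofReal (p.rho x n) * p.driving {u | Coalesces p n0 x j (numbers u)} ≤
      p.driving {u | Survives p n0 x j n (numbers u)} := by
  unfold rho
  rw [ENNReal.ofReal_sum_of_nonneg fun a _ => p.alphaProd_nonneg _ _, Finset.sum_mul]
  refine (Finset.sum_le_sum fun a _ =>
    alphaProd_mul_measure_coalesces_le hadd hn hn0 x j (List.ofFn a)).trans ?_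
  rw [← measure_biUnion_finset]
  · refine measure_mono (Set.iUnion₂_subset fun a _ u hu => ?_)
    simpa using FollowsPath.survives hu
  · intro a _ a' _ haa'
    refine Set.disjoint_left.2 fun u hu hu' => haa' (List.ofFn_injective ?_)
    exact FollowsPath.eq hu hu' (by simp)
  · exact fun a _ => measurableSet_followsPath (by omega) x j _

end Measure

/-! ### The renewal argument. -/

section Renewal

variable {p : ProbKernel A} {n0 : ℕ} {x : p.Start}

/-- The point of the canonical space seen from the time `s`. -/
def shiftPoint {S : Type*} (s : ℤ) (u : ℤ × S → ℝ) : ℤ × S → ℝ := fun i => u (i.1 + s, i.2)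

lemma measurePreserving_shiftPoint (p : ProbKernel A) (s : ℤ) :
    MeasurePreserving (shiftPoint s) p.driving p.driving := by
  refine ⟨measurable_pi_iff.2 fun i => measurable_pi_apply _, ?_⟩
  have hf : Function.Injective (fun i : ℤ × p.Start => (i.1 + s, i.2)) := by
    rintro ⟨m, a⟩ ⟨m', a'⟩ h
    simpa using h
  exact Measure.map_infinitePi_infinitePi_of_inj
    (P := fun _ : ℤ × p.Start => unitUniform) hf

lemma coalesces_timeShift (s j : ℤ) (v : ℤ → p.Start → ℝ) :
    Coalesces p n0 x j (timeShift (n0 * s) v) ↔ Coalesces p n0 x (j + s) v := by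
  unfold Coalesces
  simp only [startTraj_timeShift, winStart_add]

lemma survives_timeShift (hn0 : 0 < n0) (s j : ℤ) (n : ℕ) (v : ℤ → p.Start → ℝ) :
    Survives p n0 x j n (timeShift (n0 * s) v) ↔ Survives p n0 x (j + s) n v := by
  unfold Survives
  simp only [coalesces_timeShift, value, history_timeShift _ _ _ hn0]

lemma Survives.congr (hn0 : 0 < n0) {j : ℤ} {n : ℕ} {v v' : ℤ → p.Start → ℝ}
    (h : ∀ m, winStart n0 j ≤ m → m < winStart n0 j + n0 + n → ∀ a, v m a = v' m a) :
    Survives p n0 x j n v ↔ Survives p n0 x j n v' := by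
  refine and_congr (Coalesces.congr fun m h1 h2 => h m h1 (by omega)) ?_
  refine forall₂_congr fun s hs => ?_
  rw [value_congr hn0 _ _ fun m h1 h2 => h m h1 (by push_cast at h2; omega)]

lemma Survives.mono {j : ℤ} {n n' : ℕ} (hn : n ≤ n') {v : ℤ → p.Start → ℝ}
    (h : Survives p n0 x j n' v) : Survives p n0 x j n v :=
  ⟨h.1, fun s hs => h.2 s (hs.trans_le hn)⟩

variable (p n0 x) in
/-- No attempt that starts in a window `i` with `lo ≤ i < hi` survives the window `hi`. -/
def NoSurvivor (lo hi : ℤ) (v : ℤ → p.Start → ℝ) : Prop :=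
  ∀ i, lo ≤ i → i < hi → ¬ Survives p n0 x i (n0 * (hi - i).toNat) v

lemma noSurvivor_timeShift (hn0 : 0 < n0) (s lo hi : ℤ) (v : ℤ → p.Start → ℝ) :
    NoSurvivor p n0 x lo hi (timeShift (n0 * s) v) ↔ NoSurvivor p n0 x (lo + s) (hi + s) v := by
  unfold NoSurvivor
  simp only [survives_timeShift hn0]
  constructor
  · intro h i h1 h2
    have := h (i - s) (by omega) (by omega)
    rwa [sub_add_cancel, show hi - (i - s) = hi + s - i by ring] at this
  · intro h i h1 h2
    have := h (i + s) (by omega) (by omega)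
    rwa [show hi + s - (i + s) = hi - i by ring] at this

lemma measurableSet_noSurvivor (hn0 : 0 < n0) (lo hi : ℤ) :
    MeasurableSet {u | NoSurvivor p n0 x lo hi (numbers u)} :=
  measurableSet_setOf_forall fun i => measurableSet_setOf_forall fun _ =>
    measurableSet_setOf_forall fun _ => (measurableSet_survives hn0 x i _).compl

lemma measurableSet_survives_forever (hn0 : 0 < n0) (j : ℤ) :
    MeasurableSet {u | ∀ n, Survives p n0 x j n (numbers u)} :=
  measurableSet_setOf_forall fun n => measurableSet_survives hn0 x j n

lemma measure_noSurvivor_add (hn0 : 0 < n0) (s lo hi : ℤ) :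
    p.driving {u | NoSurvivor p n0 x (lo + s) (hi + s) (numbers u)} =
      p.driving {u | NoSurvivor p n0 x lo hi (numbers u)} := by
  rw [← (measurePreserving_shiftPoint p (n0 * s)).measure_preimage
    (measurableSet_noSurvivor hn0 lo hi).nullMeasurableSet]
  congr 1
  ext u
  exact (noSurvivor_timeShift hn0 s lo hi (numbers u)).symm

lemma measure_survives_forever_add (hn0 : 0 < n0) (s j : ℤ) :
    p.driving {u | ∀ n, Survives p n0 x (j + s) n (numbers u)} =
      p.driving {u | ∀ n, Survives p n0 x j n (numbers u)} := by
  rw [← (measurePreserving_shiftPoint p (n0 * s)).measure_preimage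
    (measurableSet_survives_forever hn0 j).nullMeasurableSet]
  congr 1
  ext u
  exact forall_congr' fun n => (survives_timeShift hn0 s j n (numbers u)).symm

/-- The bound for `n` steps is uniform in `n`, so it passes to the decreasing intersection. -/
lemma measure_survives_forever_pos (hadd : p.Extendable) (hn : 1 ≤ p.nHat) (hn0 : p.nHat ≤ n0)
    {δ : ℝ} (hδ : 0 < δ) (hρ : ∀ n, δ ≤ p.rho x n)
    (hcoal : p.driving {u | Coalesces p n0 x 0 (numbers u)} ≠ 0) :
    p.driving {u | ∀ n, Survives p n0 x 0 n (numbers u)} ≠ 0 := by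
  have hset : {u | ∀ n, Survives p n0 x 0 n (numbers u)} =
      ⋂ n, {u | Survives p n0 x 0 n (numbers u)} := by ext; simp
  have hanti : Antitone fun n => {u | Survives p n0 x 0 n (numbers u)} :=
    fun n n' h u hu => Survives.mono h hu
  have hle : ENNReal.ofReal δ * p.driving {u | Coalesces p n0 x 0 (numbers u)} ≤
      p.driving {u | ∀ n, Survives p n0 x 0 n (numbers u)} := by
    rw [hset, hanti.measure_iInter
      (fun n => (measurableSet_survives (by omega) x 0 n).nullMeasurableSet)
      ⟨0, measure_ne_top _ _⟩]
    refine le_iInf fun n => le_trans ?_ (rho_mul_measure_coalesces_le hadd hn hn0 x 0 n)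
    gcongr
    exact hρ n
  refine (lt_of_lt_of_le ?_ hle).ne'
  exact ENNReal.mul_pos (by simpa using hδ) hcoal

/-- Only survival through the window `hi` is asked for, so nothing after that window is read. This
makes the event independent of attempts starting at `hi + 1`. -/
lemma dependsOnly_noSurvivor (hn0 : 0 < n0) (lo hi : ℤ) :
    DependsOnly {u | NoSurvivor p n0 x lo hi (numbers u)} {i | i.1 < winStart n0 (hi + 1)} := by
  intro u u' h
  refine forall_congr' fun i => forall_congr' fun _ => forall_congr' fun hi' => not_congr ?_
  refine Survives.congr hn0 fun m _ h2 a => h (m, a) ?_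
  have e : (((hi - i).toNat : ℕ) : ℤ) = hi - i := Int.toNat_of_nonneg (by omega)
  push_cast at h2
  rw [e] at h2
  have : winStart n0 (hi + 1) = winStart n0 i + n0 + n0 * (hi - i) := by unfold winStart; ring
  simpa [this] using h2

lemma dependsOnly_survives_forever (hn0 : 0 < n0) (j : ℤ) :
    DependsOnly {u | ∀ n, Survives p n0 x j n (numbers u)} {i | winStart n0 j ≤ i.1} :=
  fun _ _ h => forall_congr' fun _ => Survives.congr hn0 fun m h1 _ a => h (m, a) h1

/-- Each failure event up to `M` is paired with an independent attempt at `M + 1` that lasts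
forever. The pairs have probability `b_M q` and overlap so little that their total is at most `2`.
-/
lemma tsum_measure_noSurvivor_ne_top (hn0 : 0 < n0)
    (hq : p.driving {u | ∀ n, Survives p n0 x 0 n (numbers u)} ≠ 0) :
    ∑' M : ℕ, p.driving {u | NoSurvivor p n0 x 0 M (numbers u)} ≠ ⊤ := by
  set q := p.driving {u | ∀ n, Survives p n0 x 0 n (numbers u)} with hqdef
  let G : ℕ → Set (ℤ × p.Start → ℝ) := fun M =>
    {u | NoSurvivor p n0 x 0 M (numbers u)} ∩ {u | ∀ n, Survives p n0 x (M + 1) n (numbers u)}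
  have hGm : ∀ M, MeasurableSet (G M) := fun M =>
    (measurableSet_noSurvivor hn0 _ _).inter (measurableSet_survives_forever hn0 _)
  have hG : ∀ M, p.driving (G M) = p.driving {u | NoSurvivor p n0 x 0 M (numbers u)} * q := by
    intro M
    rw [hqdef, ← measure_survives_forever_add hn0 (M + 1 : ℤ) 0, zero_add]
    refine measure_inter_of_dependsOnly (fun _ => unitUniform) (measurableSet_noSurvivor hn0 _ _)
      (measurableSet_survives_forever hn0 _) (dependsOnly_noSurvivor hn0 _ _)
      (dependsOnly_survives_forever hn0 _) ?_
    rw [Set.disjoint_left]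
    intro i h1 h2
    simp only [Set.mem_ofPred_eq] at h1 h2
    exact absurd h1 (not_lt.2 h2)
  -- Eternal survival from `M + 1` contradicts failure up to `M'` only if `M + 1 < M'`; hence the
  -- separate treatment of even and odd indices.
  have hdisj : ∀ M M', M + 2 ≤ M' → Disjoint (G M) (G M') := by
    intro M M' h
    rw [Set.disjoint_left]
    rintro u ⟨-, hu⟩ ⟨hu', -⟩
    exact hu' (M + 1) (by omega) (by omega) (hu _)
  have hpair : ∀ e, Pairwise (Function.onFun Disjoint fun M => G (2 * M + e)) := by
    intro e M M' h
    rcases lt_or_gt_of_ne h with h | h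
    · exact hdisj _ _ (by omega)
    · exact (hdisj _ _ (by omega)).symm
  have hle : ∀ e, ∑' M, p.driving (G (2 * M + e)) ≤ 1 := by
    intro e
    rw [← measure_iUnion (hpair e) fun M => hGm _]
    exact prob_le_one
  have hsum : (∑' M : ℕ, p.driving {u | NoSurvivor p n0 x 0 M (numbers u)}) * q ≤ 2 := by
    rw [← ENNReal.tsum_mul_right]
    simp only [← hG]
    rw [← tsum_even_add_odd ENNReal.summable ENNReal.summable]
    refine le_of_le_of_eq ?_ one_add_one_eq_two
    exact add_le_add (hle 0) (hle 1)
  intro htop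
  rw [htop, ENNReal.top_mul hq] at hsum
  exact absurd hsum (by simp)

end Renewal

/-! ### From failed attempts to the coalescence times. -/

section Coalescence

variable {p : ProbKernel A} {n0 : ℕ} {x : p.Start} {v : ℤ → p.Start → ℝ}

lemma Ttilde_le (n : ℤ) : p.Ttilde n0 v n ≤ ((winIndex n0 n : ℝ) : EReal) :=
  iSup₂_le fun j hj => by exact_mod_cast hj.1

/-- An attempt from a window `i ≥ -N` that survives the window of `n` makes `X^{(i)}_n` known, which
forces `T̃[n] ≥ i`. -/
lemma noSurvivor_of_Ttilde_lt (hn0 : 0 < n0) {n : ℤ} {N : ℕ}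
    (h : p.Ttilde n0 v n < ((-(N : ℝ) : ℝ) : EReal)) :
    NoSurvivor p n0 x (-N) (winIndex n0 n) v := by
  intro i h1 h2 hs
  refine absurd h (not_lt.2 ?_)
  have hval : p.tempValue n0 v i n ≠ ⊤ := by
    set K := winIndex n0 n with hK
    have e : (((K - i).toNat : ℕ) : ℤ) = K - i := Int.toNat_of_nonneg (by omega)
    have hn0' : (0 : ℤ) < n0 := by exact_mod_cast hn0
    have hdiv := Int.mul_ediv_add_emod (n - 1) n0
    have hmod0 := Int.emod_nonneg (n - 1) hn0'.ne'
    have hmod1 := Int.emod_lt_of_pos (n - 1) hn0'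
    have hKe : (n - 1) / n0 = K - 1 := by rw [hK, winIndex]; ring
    rw [hKe] at hdiv
    have hmul : (n0 : ℤ) * 1 ≤ n0 * (K - i) := by gcongr; omega
    have h3 : n - winStart n0 i - n0 = (n0 : ℤ) * (K - i) - n0 + (n - 1) % n0 := by
      rw [winStart]; linarith [hdiv]
    obtain ⟨s, hs'⟩ := Int.eq_ofNat_of_zero_le (a := n - winStart n0 i - n0) (by omega)
    have hlt : s < n0 * (K - i).toNat := by
      zify
      rw [e]
      omega
    have ht : (n - winStart n0 i + 1).toNat = n0 + s + 1 := by omega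
    have := hs.2 s hlt
    unfold tempValue
    rw [ht]
    exact this
  refine le_trans ?_ (le_iSup₂ (f := fun (j : ℤ) (_ : j ≤ winIndex n0 n ∧
    p.tempValue n0 v j n ≠ ⊤) => ((j : ℝ) : EReal)) i ⟨h2.le, hval⟩)
  exact_mod_cast h1

lemma winIndex_zero (hn0 : 0 < n0) : winIndex n0 0 = 0 := by
  unfold winIndex
  rw [Int.ediv_eq_neg_one_of_neg_of_le (by omega) (by omega)]
  rfl

lemma winIndex_mono (hn0 : 0 < n0) : Monotone (winIndex n0) := by
  intro m n h
  have := Int.ediv_le_ediv (a := m - 1) (b := n - 1) (c := n0) (by omega) (by omega)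
  unfold winIndex
  omega

/-- The series counts the integers `N ≥ 0` below `|T|`; for `T = -∞` every term is `1`. -/
lemma abs_le_tsum {T : EReal} (hT : T ≤ 0) :
    T.abs ≤ ∑' N : ℕ, if T < ((-(N : ℝ) : ℝ) : EReal) then 1 else 0 := by
  induction T with
  | bot =>
    simp only [EReal.bot_lt_coe, if_true,
      ENNReal.tsum_const_eq_top_of_ne_zero one_ne_zero, le_top]
  | top => simp at hT
  | coe r =>
    have hr : r ≤ 0 := by exact_mod_cast hT
    have h1 : ((r : EReal).abs) ≤ (⌈-r⌉₊ : ENNReal) := by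
      rw [EReal.abs_def, abs_of_nonpos hr]
      exact ENNReal.ofReal_le_of_le_toReal (by simpa using Nat.le_ceil (-r))
    refine h1.trans ?_
    have h2 : ∀ N ∈ Finset.range ⌈-r⌉₊,
        (if (r : EReal) < ((-(N : ℝ) : ℝ) : EReal) then (1 : ENNReal) else 0) = 1 := by
      intro N hN
      rw [if_pos]
      have := Nat.lt_ceil.1 (Finset.mem_range.1 hN)
      exact_mod_cast (by linarith : r < -(N : ℝ))
    calc (⌈-r⌉₊ : ENNReal) = ∑ N ∈ Finset.range ⌈-r⌉₊,
          (if (r : EReal) < ((-(N : ℝ) : ℝ) : EReal) then (1 : ENNReal) else 0) := by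
          rw [Finset.sum_congr rfl h2]; simp
      _ ≤ _ := ENNReal.sum_le_tsum _

lemma exists_noSurvivor_of_TtildeIci_lt (hn0 : 0 < n0) {m : ℤ} (hm : 0 ≤ m) {N : ℕ}
    (h : p.TtildeIci n0 v m < ((-(N : ℝ) : ℝ) : EReal)) :
    ∃ K : ℕ, NoSurvivor p n0 x (-N) K v := by
  simp only [TtildeIci, iInf_lt_iff] at h
  obtain ⟨k, hk, h⟩ := h
  have h0 : 0 ≤ winIndex n0 k := winIndex_zero hn0 ▸ winIndex_mono hn0 (hm.trans hk)
  obtain ⟨K, hK⟩ := Int.eq_ofNat_of_zero_le h0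
  exact ⟨K, hK ▸ noSurvivor_of_Ttilde_lt hn0 h⟩

lemma exists_noSurvivor_of_TtildeIcc_lt (hn0 : 0 < n0) {m n : ℤ} (hm : 0 ≤ m) {N : ℕ}
    (h : p.TtildeIcc n0 v m n < ((-(N : ℝ) : ℝ) : EReal)) :
    ∃ K ∈ Finset.range ((winIndex n0 n).toNat + 1), NoSurvivor p n0 x (-N) K v := by
  simp only [TtildeIcc, iInf_lt_iff] at h
  obtain ⟨k, hk, h⟩ := h
  have h0 : 0 ≤ winIndex n0 k := winIndex_zero hn0 ▸ winIndex_mono hn0 (hm.trans hk.1)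
  have h1 := winIndex_mono hn0 hk.2
  obtain ⟨K, hK⟩ := Int.eq_ofNat_of_zero_le h0
  exact ⟨K, by rw [Finset.mem_range]; omega, hK ▸ noSurvivor_of_Ttilde_lt hn0 h⟩

lemma TtildeIcc_nonpos (hn0 : 0 < n0) {n : ℤ} (hn : 0 ≤ n) : p.TtildeIcc n0 v 0 n ≤ 0 := by
  refine (iInf₂_le (0 : ℤ) ⟨le_rfl, hn⟩).trans ((Ttilde_le 0).trans ?_)
  simp [winIndex_zero hn0]

lemma TtildeIci_nonpos (hn0 : 0 < n0) : p.TtildeIci n0 v 0 ≤ 0 := by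
  refine (iInf₂_le (0 : ℤ) (Set.mem_Ici.2 le_rfl)).trans ((Ttilde_le 0).trans ?_)
  simp [winIndex_zero hn0]

variable {Ω : Type*} [MeasurableSpace Ω] {μ : Measure Ω} {U : ℤ → p.Start → Ω → ℝ}

lemma measure_noSurvivor_eq (hn0 : 0 < n0)
    (hU : MeasurePreserving (fun ω (i : ℤ × p.Start) => U i.1 i.2 ω) μ p.driving) (N K : ℕ) :
    μ {ω | NoSurvivor p n0 x (-N) K fun m a => U m a ω} =
      p.driving {u | NoSurvivor p n0 x 0 ((N + K : ℕ) : ℤ) (numbers u)} := by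
  have h := measure_noSurvivor_add (p := p) (x := x) hn0 (-N) 0 ((N + K : ℕ) : ℤ)
  rw [zero_add, show ((N + K : ℕ) : ℤ) + -N = K by push_cast; ring] at h
  rw [← h, ← hU.measure_preimage (measurableSet_noSurvivor hn0 _ _).nullMeasurableSet]
  rfl

lemma lintegral_abs_TtildeIcc_lt_top (hn0 : 0 < n0)
    (hq : p.driving {u | ∀ n, Survives p n0 x 0 n (numbers u)} ≠ 0)
    (hU : MeasurePreserving (fun ω (i : ℤ × p.Start) => U i.1 i.2 ω) μ p.driving) {n : ℤ}
    (hn : 0 ≤ n) :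
    ∫⁻ ω, (p.TtildeIcc n0 (fun m a => U m a ω) 0 n).abs ∂μ < ⊤ := by
  set b : ℕ → ENNReal := fun M => p.driving {u | NoSurvivor p n0 x 0 M (numbers u)} with hb
  have hsum := tsum_measure_noSurvivor_ne_top hn0 hq
  set R := Finset.range ((winIndex n0 n).toNat + 1)
  have hmeas : ∀ N K : ℕ, MeasurableSet {ω | NoSurvivor p n0 x (-N) K fun m a => U m a ω} :=
    fun N K => hU.measurable (measurableSet_noSurvivor hn0 (x := x) (-N) K)
  calc ∫⁻ ω, (p.TtildeIcc n0 (fun m a => U m a ω) 0 n).abs ∂μ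
      ≤ ∫⁻ ω, ∑' N : ℕ, ∑ K ∈ R,
          {ω | NoSurvivor p n0 x (-N) K fun m a => U m a ω}.indicator 1 ω ∂μ := by
        refine lintegral_mono fun ω => (abs_le_tsum (TtildeIcc_nonpos hn0 hn)).trans ?_
        refine ENNReal.tsum_le_tsum fun N => ?_
        split_ifs with h
        · obtain ⟨K, hK, hbad⟩ := exists_noSurvivor_of_TtildeIcc_lt (x := x) hn0 le_rfl h
          refine le_trans ?_ (Finset.single_le_sum (fun _ _ => zero_le) hK)
          rw [Set.indicator_of_mem hbad]
          rfl
        · exact zero_le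
    _ = ∑' N : ℕ, ∑ K ∈ R, b (N + K) := by
        rw [lintegral_tsum]
        · refine tsum_congr fun N => ?_
          rw [lintegral_finsetSum]
          · refine Finset.sum_congr rfl fun K _ => ?_
            rw [lintegral_indicator_one (hmeas N K), measure_noSurvivor_eq hn0 hU]
          · exact fun K _ => measurable_one.indicator (hmeas N K)
        · exact fun N => (Finset.measurable_fun_sum _ fun K _ =>
            measurable_one.indicator (hmeas N K)).aemeasurable
    _ = ∑ K ∈ R, ∑' N : ℕ, b (N + K) := by
        exact Summable.tsum_finsetSum fun _ _ => ENNReal.summable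
    _ ≤ ∑ _K ∈ R, ∑' M, b M :=
        Finset.sum_le_sum fun K _ =>
          ENNReal.tsum_comp_le_tsum_of_injective (add_left_injective K) b
    _ < ⊤ := ENNReal.sum_lt_top.2 fun _ _ => hsum.lt_top

/-- If the infimum is `-∞`, then for every `N` some `K` sees only failures from `-N` on. The
probability of this is at most the tail `∑_K b_{N+K}`, which tends to `0`. -/
lemma ae_abs_TtildeIci_lt_top (hn0 : 0 < n0)
    (hq : p.driving {u | ∀ n, Survives p n0 x 0 n (numbers u)} ≠ 0)
    (hU : MeasurePreserving (fun ω (i : ℤ × p.Start) => U i.1 i.2 ω) μ p.driving) :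
    ∀ᵐ ω ∂μ, (p.TtildeIci n0 (fun m a => U m a ω) 0).abs < ⊤ := by
  set b : ℕ → ENNReal := fun M => p.driving {u | NoSurvivor p n0 x 0 M (numbers u)} with hb
  have hsum := tsum_measure_noSurvivor_ne_top hn0 hq
  have hle : ∀ N : ℕ, μ {ω | p.TtildeIci n0 (fun m a => U m a ω) 0 = ⊥} ≤ ∑' K, b (K + N) := by
    intro N
    calc μ {ω | p.TtildeIci n0 (fun m a => U m a ω) 0 = ⊥}
        ≤ μ (⋃ K : ℕ, {ω | NoSurvivor p n0 x (-N) K fun m a => U m a ω}) := by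
          refine measure_mono fun ω hω => Set.mem_iUnion.2 ?_
          refine exists_noSurvivor_of_TtildeIci_lt hn0 le_rfl ?_
          rw [show p.TtildeIci n0 (fun m a => U m a ω) 0 = ⊥ from hω]
          exact EReal.bot_lt_coe _
      _ ≤ ∑' K : ℕ, μ {ω | NoSurvivor p n0 x (-N) K fun m a => U m a ω} :=
          measure_iUnion_le _
      _ = ∑' K, b (K + N) := by
          refine tsum_congr fun K => ?_
          rw [measure_noSurvivor_eq hn0 hU, hb, add_comm]
  have hzero : μ {ω | p.TtildeIci n0 (fun m a => U m a ω) 0 = ⊥} = 0 :=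
    le_antisymm (ge_of_tendsto' (ENNReal.tendsto_sum_nat_add b hsum) hle) zero_le
  have hae : ∀ᵐ ω ∂μ, p.TtildeIci n0 (fun m a => U m a ω) 0 ≠ ⊥ := by
    rw [ae_iff]
    simpa using hzero
  filter_upwards [hae] with ω hω
  have h0 := TtildeIci_nonpos (p := p) (v := fun m a => U m a ω) hn0
  generalize p.TtildeIci n0 (fun m a => U m a ω) 0 = T at hω h0
  induction T with
  | bot => exact absurd rfl hω
  | top => simp at h0
  | coe r => rw [EReal.abs_def]; exact ENNReal.ofReal_lt_top

end Coalescence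

/-! ### Finite chains with one aperiodic closed class. -/

section Chain

variable {S : Type*} [Fintype S] {P : Matrix S S ℝ}

/-- From `i` the chain can be in `j` after exactly `m` steps. -/
def Steps (P : Matrix S S ℝ) : ℕ → S → S → Prop
  | 0, i, j => i = j
  | m + 1, i, j => ∃ l, Steps P m i l ∧ 0 < P l j

lemma pow_nonneg_and_pos_iff_steps (hP : ∀ i j, 0 ≤ P i j) (m : ℕ) (i j : S) :
    0 ≤ (P ^ m) i j ∧ (0 < (P ^ m) i j ↔ Steps P m i j) := by
  induction m generalizing j with
  | zero =>
    rw [pow_zero, Matrix.one_apply, Steps]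
    split_ifs with h <;> simp [h]
  | succ m ih =>
    have hterm : ∀ l ∈ Finset.univ, 0 ≤ (P ^ m) i l * P l j :=
      fun l _ => mul_nonneg (ih l).1 (hP l j)
    rw [pow_succ, Matrix.mul_apply]
    refine ⟨Finset.sum_nonneg hterm, ?_⟩
    rw [Finset.sum_pos_iff_of_nonneg hterm]
    simp only [Finset.mem_univ, true_and, Steps]
    refine exists_congr fun l => ?_
    rw [← (ih l).2]
    constructor
    · intro h
      refine ⟨lt_of_le_of_ne (ih l).1 fun h0 => ?_, lt_of_le_of_ne (hP l j) fun h0 => ?_⟩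
      · simp [← h0] at h
      · simp [← h0] at h
    · rintro ⟨h1, h2⟩
      exact mul_pos h1 h2

lemma Steps.add {m n : ℕ} {i j k : S} (h : Steps P m i j) (h' : Steps P n j k) :
    Steps P (m + n) i k := by
  induction n generalizing k with
  | zero => rw [Steps] at h'; exact h' ▸ h
  | succ n ih =>
    obtain ⟨l, h1, h2⟩ := h'
    exact ⟨l, ih h1, h2⟩

lemma accessible_iff (hP : ∀ i j, 0 ≤ P i j) (i j : S) :
    Accessible P i j ↔ ∃ m, Steps P m i j :=
  exists_congr fun m => (pow_nonneg_and_pos_iff_steps hP m i j).2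

/-- Among the states reachable from `i`, one with the fewest reachable states is reached back from
all of them, so its reachable set is a closed class. -/
lemma exists_isClosedClass_of_nonneg (hP : ∀ i j, 0 ≤ P i j) (i : S) :
    ∃ K, IsClosedClass P K ∧ ∃ j ∈ K, ∃ m, Steps P m i j := by
  have htrans : ∀ {i j k}, (∃ m, Steps P m i j) → (∃ m, Steps P m j k) → ∃ m, Steps P m i k := by
    rintro i j k ⟨m, h⟩ ⟨n, h'⟩
    exact ⟨_, h.add h'⟩
  have hrefl : ∀ i, ∃ m, Steps P m i i := fun i => ⟨0, rfl⟩
  let reach : S → Finset S := fun c => Finset.univ.filter fun j => ∃ m, Steps P m c j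
  obtain ⟨c, hc, hmin⟩ := Finset.exists_min_image (reach i) (fun c => (reach c).card)
    ⟨i, by simpa [reach] using hrefl i⟩
  have hback : ∀ j, (∃ m, Steps P m c j) → ∃ m, Steps P m j c := by
    intro j hj
    have hsub : reach j ⊆ reach c := fun k hk => by
      simp only [reach, Finset.mem_filter, Finset.mem_univ, true_and] at hk ⊢
      exact htrans hj hk
    have hji : j ∈ reach i := by
      simp only [reach, Finset.mem_filter, Finset.mem_univ, true_and] at hc ⊢
      exact htrans hc hj
    have heq := Finset.eq_of_subset_of_card_le hsub (hmin j hji)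
    have : c ∈ reach j := heq ▸ (by simpa [reach] using hrefl c)
    simpa [reach] using this
  refine ⟨{j | ∃ m, Steps P m c j}, ⟨⟨c, hrefl c⟩, fun k hk j => ?_, fun k hk j hj => ?_⟩,
    c, hrefl c, by simpa [reach] using hc⟩
  · rw [accessible_iff hP, accessible_iff hP]
    constructor
    · intro hj
      exact ⟨htrans (hback k hk) hj, htrans (hback j hj) hk⟩
    · rintro ⟨h, -⟩
      exact htrans hk h
  · by_contra h0
    exact hj (htrans hk ⟨1, k, rfl, lt_of_le_of_ne (hP k j) (Ne.symm h0)⟩)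

/-- Return times are closed under addition and have greatest common divisor `1`, so they include all
large integers. -/
lemma exists_forall_steps_self (hP : ∀ i j, 0 ≤ P i j) {K : Set S} (hK : IsAperiodicClass P K)
    {c : S} (hc : c ∈ K) : ∃ M, ∀ m ≥ M, Steps P m c c := by
  obtain ⟨M, hM⟩ := Nat.exists_mem_closure_of_ge {m | 1 ≤ m ∧ Steps P m c c}
  have hgcd : Nat.setGcd {m | 1 ≤ m ∧ Steps P m c c} = 1 :=
    hK c hc _ fun m hm hpos =>
      Nat.setGcd_dvd_of_mem ⟨hm, (pow_nonneg_and_pos_iff_steps hP m c c).2.1 hpos⟩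
  refine ⟨M, fun m hm => ?_⟩
  have := hM m hm (by rw [hgcd]; exact one_dvd m)
  refine AddSubmonoid.closure_induction (motive := fun m _ => Steps P m c c)
    (fun _ h => h.2) ?_ (fun _ _ _ _ h h' => Steps.add h h') this
  rfl

/-- If there is one closed class, and it is aperiodic, then all its states can be reached from
everywhere in any large number of steps. -/
lemma exists_forall_steps (hP : ∀ i j, 0 ≤ P i j) {K : Set S} (hK : IsClosedClass P K)
    (huniq : ∀ K', IsClosedClass P K' → K' = K) (hap : IsAperiodicClass P K) :
    ∃ M, ∀ m ≥ M, ∀ a, ∀ b ∈ K, Steps P m a b := by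
  obtain ⟨c, hc⟩ := hK.1
  obtain ⟨M, hM⟩ := exists_forall_steps_self hP hap hc
  have hfrom : ∀ b ∈ K, ∃ m, Steps P m c b := fun b hb =>
    (accessible_iff hP c b).1 ((hK.2.1 c hc b).1 hb).1
  have hto : ∀ a, ∃ m, Steps P m a c := by
    intro a
    obtain ⟨K', hK', j, hj, m, hm⟩ := exists_isClosedClass_of_nonneg hP a
    rw [huniq K' hK'] at hj
    obtain ⟨n, hn⟩ := (accessible_iff hP c j).1 ((hK.2.1 c hc j).1 hj).1
    obtain ⟨n', hn'⟩ := (accessible_iff hP j c).1 ((hK.2.1 c hc j).1 hj).2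
    exact ⟨_, hm.add hn'⟩
  choose s hs using hto
  choose! r hr using hfrom
  -- A path goes from `a` to `c`, loops at `c` for the remaining time, then goes to `b`. The sums
  -- bound all `s a` and `r b` at once, so one threshold serves every pair.
  refine ⟨M + ∑ a, s a + ∑ b, r b, fun m hm a b hb => ?_⟩
  have h1 : s a ≤ ∑ a, s a := Finset.single_le_sum (fun _ _ => Nat.zero_le _) (Finset.mem_univ a)
  have h2 : r b ≤ ∑ b, r b := Finset.single_le_sum (fun _ _ => Nat.zero_le _) (Finset.mem_univ b)
  have := ((hs a).add (hM (m - s a - r b) (by omega))).add (hr b hb)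
  rwa [show s a + (m - s a - r b) + r b = m by omega] at this

end Chain

variable {p : ProbKernel A}

/-! ### From steps of the chain to simultaneous coalescence. -/

section Words

lemma markovMatrix_nonneg (n : ℕ) (i j : p.Past n) : 0 ≤ p.markovMatrix n i j := by
  refine Finset.sum_nonneg fun g _ => ?_
  split_ifs
  · exact div_nonneg (p.alpha_nonneg _ _) (p.beta_nonneg _)
  · exact le_rfl

/-- A positive transition gives positive `α` at the last `n` symbols, and monotonicity carries this
to the whole string since `a`. -/
lemma exists_word_of_steps (hadd : p.Extendable) {n m : ℕ} {a b : p.Past n}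
    (h : Steps (p.markovMatrix n) m a b) :
    ∃ w : List A, w.length = m ∧ 0 < p.alphaProd w (str a.1) ∧
      (known w ++ str a.1).take n = str b.1 := by
  induction m generalizing b with
  | zero =>
    rw [Steps] at h
    subst h
    exact ⟨[], rfl, by simp [alphaProd], take_eq_str_of_refines (Refines.refl _)⟩
  | succ m ih =>
    obtain ⟨l, h1, h2⟩ := h
    obtain ⟨w, hw, hpos, htake⟩ := ih h1
    obtain ⟨g, -, hg⟩ := Finset.exists_lt_of_sum_lt (s := Finset.univ)
      (f := fun _ : A => (0 : ℝ)) (by simpa [markovMatrix] using h2)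
    split_ifs at hg with hb
    · have hr := refines_str_of_take_eq htake
      obtain ⟨h, hh, hf⟩ := exists_admissible_fits a
      obtain ⟨hh1, hh2⟩ := hadd.prepend_of_alphaProd_pos (Refines.refl _) hh hf hpos
      have hag : 0 < p.alpha g (str l.1) := by
        refine lt_of_le_of_ne (p.alpha_nonneg _ _) fun h0 => ?_
        simp [pMarkov, ← h0] at hg
      refine ⟨g :: w, by simp [hw], ?_, take_eq_str_of_refines ?_⟩
      · rw [alphaProd_cons]
        exact mul_pos (hag.trans_le (alpha_mono ⟨_, hh1, hh2⟩ hr g)) hpos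
      · intro k c hk
        obtain ⟨hk', hc⟩ := (str_getElem? _ _ _).1 hk
        rw [hb] at hc
        rw [known_cons, List.cons_append]
        cases k with
        | zero =>
          rw [← hc]
          rfl
        | succ k =>
          rw [List.getElem?_cons_succ]
          refine hr k c ((str_getElem? _ _ _).2 ⟨by omega, ?_⟩)
          rw [← hc]
          rfl
    · exact absurd hg (lt_irrefl _)

/-- Each symbol is drawn when its number falls into an interval whose length is the corresponding
factor of the weight. -/
lemma exists_sets_of_alphaProd_pos {w : List A} {a : List (WithTop A)}
    (h : 0 < p.alphaProd w a) :
    ∃ S : ℕ → Set ℝ, (∀ t, MeasurableSet (S t)) ∧ (∀ t, unitUniform (S t) ≠ 0) ∧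
      ∀ v : ℕ → ℝ, (∀ t < w.length, v t ∈ S t) → p.traj v a w.length = known w := by
  induction w with
  | nil => exact ⟨fun _ => Set.univ, fun _ => .univ, fun _ => by simp, fun _ _ => rfl⟩
  | cons g w ih =>
    obtain ⟨h1, h2⟩ := pos_of_alphaProd_cons_pos h
    obtain ⟨S, hS1, hS2, hS3⟩ := ih h2
    let D : Set ℝ := {v | v ∈ Set.Ico (0 : ℝ) 1 ∧ p.draw v (known w ++ a) = g}
    have hD : unitUniform D ≠ 0 := by
      unfold unitUniform
      rw [Measure.restrict_eq_self _ fun v hv => hv.1, (hasLaw_draw (known w ++ a)).2 g]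
      simpa using h1
    have hDm : MeasurableSet D := by
      simp only [D, setOf_draw_eq]
      exact measurableSet_Ico
    refine ⟨fun t => if t < w.length then S t else D, fun t => ?_, fun t => ?_, fun v hv => ?_⟩
    · dsimp only
      split_ifs
      exacts [hS1 t, hDm]
    · dsimp only
      split_ifs
      exacts [hS2 t, hD]
    · have hw : p.traj v a w.length = known w := by
        refine hS3 v fun t ht => ?_
        have := hv t (by rw [List.length_cons]; omega)
        simpa only [if_pos ht] using this
      have hlast := hv w.length (by simp)
      simp only [lt_irrefl, if_false] at hlast
      rw [List.length_cons, traj, hw, hlast.2]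
      rfl

/-- The trajectories started from all of `C` follow words of positive weight with positive
probability. -/
lemma measure_forall_traj_pos {m : ℕ} {w : p.Start → List A} (hlen : ∀ a, (w a).length = m)
    (hpos : ∀ a, 0 < p.alphaProd (w a) (str a.1)) :
    0 < p.driving {u | ∀ a : p.Start, p.traj (fun t => u (t, a)) (str a.1) m = known (w a)} := by
  choose S hS1 hS2 hS3 using fun a => exists_sets_of_alphaProd_pos (hpos a)
  -- Different starts use different numbers, so their words can be prescribed independently, even if
  -- the trajectories meet.
  let box : Set (ℤ × p.Start → ℝ) :=
    Set.pi (Finset.Ico (0 : ℤ) m ×ˢ (Finset.univ : Finset p.Start) : Finset (ℤ × p.Start))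
      fun i => S i.2 i.1.toNat
  have hbox : 0 < p.driving box := by
    unfold driving
    rw [Measure.infinitePi_pi _ fun i _ => hS1 _ _]
    exact pos_iff_ne_zero.2 (Finset.prod_ne_zero_iff.2 fun i _ => hS2 _ _)
  refine hbox.trans_le (measure_mono fun u hu a => ?_)
  have := hS3 a (fun t => u (t, a)) fun t ht => by
    have := hu ((t : ℤ), a) (by
      have := hlen a
      simp only [Finset.coe_product, Set.mem_prod, Finset.mem_coe, Finset.mem_Ico,
        Finset.mem_univ, and_true]
      omega)
    simpa using this
  rwa [hlen a] at this

end Words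

/-! ### The time `n₀`, the choice of `x`, and the theorem. -/

section Main

lemma StandingAssumption.goodOrder_nHat (hp : p.StandingAssumption) : p.GoodOrder p.nHat :=
  Nat.sInf_mem hp.2

/-- This makes the set defining `n₀` nonempty, excluding the default value `sInf ∅ = 0`. -/
lemma exists_coalescing_time (hadd : p.Extendable) (hp : p.StandingAssumption) :
    ∃ m, p.nHat ≤ m ∧ ∀ b ∈ p.closedClass, 0 < p.driving {u | ∀ a : p.Start,
      (p.traj (fun t => u (t, a)) (str a.1) m).take p.nHat = str b.1} := by
  obtain ⟨-, -, ⟨K, hK, huniq⟩, hap⟩ := hp.goodOrder_nHat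
  obtain ⟨M, hM⟩ := exists_forall_steps (markovMatrix_nonneg p.nHat) hK huniq (hap K hK)
  refine ⟨max M p.nHat, le_max_right _ _, fun b hb => ?_⟩
  obtain ⟨K', hK', hbK⟩ := hb
  rw [huniq K' hK'] at hbK
  choose w hw1 hw2 hw3 using fun a =>
    exists_word_of_steps hadd (hM (max M p.nHat) (le_max_left _ _) a b hbK)
  refine (measure_forall_traj_pos hw1 hw2).trans_le (measure_mono fun u hu a => ?_)
  rw [hu a, ← hw3 a, List.take_append_of_le_length]
  simp [known, hw1 a]

/-- Summing over the newest symbol produces a factor `β ≤ 1`. -/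
lemma rho_succ_le (x : p.Start) (n : ℕ) : p.rho x (n + 1) ≤ p.rho x n := by
  unfold rho
  rw [← (Fin.consEquiv fun _ : Fin (n + 1) => A).sum_comp, Fintype.sum_prod_type_right]
  refine Finset.sum_le_sum fun a _ => ?_
  have : ∀ g : A, p.alphaProd (List.ofFn (Fin.consEquiv (fun _ : Fin (n + 1) => A) (g, a)))
      (str x.1) = p.alpha g (known (List.ofFn a) ++ str x.1) *
        p.alphaProd (List.ofFn a) (str x.1) := by
    intro g
    rw [← alphaProd_cons]
    simp [Fin.consEquiv, List.ofFn_succ]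
  simp only [this]
  rw [← Finset.sum_mul]
  exact mul_le_of_le_one_left (p.alphaProd_nonneg _ _) (p.beta_le_one _)

lemma rho_antitone (x : p.Start) : Antitone (p.rho x) := antitone_nat_of_succ_le (rho_succ_le x)

/-- The limit `L > 0` is the finite sum over `𝒰` of decreasing limits, so one of these is positive.
-/
lemma exists_rho_ge {c L : ℝ} (hc : 0 < c) (hL : Tendsto p.rhoTilde atTop (𝓝 L)) (hcL : c ≤ L) :
    ∃ x ∈ p.closedClass, ∃ δ > 0, ∀ n, δ ≤ p.rho x n := by
  have hbdd : ∀ x, BddBelow (Set.range (p.rho x)) := fun x =>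
    ⟨0, by rintro r ⟨n, rfl⟩; exact Finset.sum_nonneg fun _ _ => p.alphaProd_nonneg _ _⟩
  have hlim : Tendsto p.rhoTilde atTop (𝓝 (∑ x : p.closedClass, ⨅ n, p.rho x.1 n)) :=
    tendsto_finsetSum _ fun x _ => tendsto_atTop_ciInf (rho_antitone x.1) (hbdd x.1)
  have heq := tendsto_nhds_unique hL hlim
  obtain ⟨x, -, hx⟩ : ∃ x ∈ (Finset.univ : Finset p.closedClass), 0 < ⨅ n, p.rho x.1 n := by
    by_contra! h
    have := Finset.sum_nonpos h
    linarith
  exact ⟨x.1, x.2, _, hx, fun n => ciInf_le (hbdd x.1) n⟩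

variable {Ω : Type*} [MeasurableSpace Ω] {μ : Measure Ω} {U : ℤ → p.Start → Ω → ℝ}

lemma measurePreserving_driving [IsProbabilityMeasure μ] (hmeas : ∀ m a, Measurable (U m a))
    (hunif : ∀ m a, μ.map (U m a) = (volume : Measure ℝ).restrict (Set.Ico 0 1))
    (hindep : iIndepFun (fun i : ℤ × p.Start => U i.1 i.2) μ) :
    MeasurePreserving (fun ω (i : ℤ × p.Start) => U i.1 i.2 ω) μ p.driving := by
  refine ⟨measurable_pi_iff.2 fun i => hmeas _ _, ?_⟩
  rw [hindep.map_fun_eq_infinitePi_map fun i => hmeas _ _]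
  unfold driving unitUniform
  simp only [hunif]

lemma measure_traj_eq (hU : MeasurePreserving (fun ω (i : ℤ × p.Start) => U i.1 i.2 ω) μ p.driving)
    (m : ℕ) (b : p.Start) :
    μ {ω | ∀ a : p.Start,
        (p.traj (fun t => U (t : ℤ) a ω) (str a.1) m).take p.nHat = str b.1} =
      p.driving {u | ∀ a : p.Start,
        (p.traj (fun t => u (t, a)) (str a.1) m).take p.nHat = str b.1} := by
  have hm : MeasurableSet {u : ℤ × p.Start → ℝ | ∀ a : p.Start,
      (p.traj (fun t => u (t, a)) (str a.1) m).take p.nHat = str b.1} :=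
    measurableSet_setOf_forall fun a =>
      (levelMeasurable_traj (v := fun (t : ℕ) (u : ℤ × p.Start → ℝ) => u (t, a))
        (fun _ => measurable_pi_apply _) _ _).measurableSet fun w => w.take p.nHat = str b.1
  rw [← hU.measure_preimage hm.nullMeasurableSet]
  rfl

lemma nZero_spec (hadd : p.Extendable) (hp : p.StandingAssumption)
    (hU : MeasurePreserving (fun ω (i : ℤ × p.Start) => U i.1 i.2 ω) μ p.driving) {n0 : ℕ}
    (hn0 : n0 = p.nZero μ (fun t a => U (t : ℤ) a)) :
    p.nHat ≤ n0 ∧ ∀ b ∈ p.closedClass, p.driving {u | Coalesces p n0 b 0 (numbers u)} ≠ 0 := by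
  obtain ⟨m, hm, hm'⟩ := exists_coalescing_time hadd hp
  have hmem : n0 ∈ {m : ℕ | p.nHat ≤ m ∧ ∀ b ∈ p.closedClass, 0 < μ {ω | ∀ a : p.Start,
      (p.traj (fun t => U (t : ℤ) a ω) (str a.1) m).take p.nHat = str b.1}} := by
    rw [hn0]
    exact Nat.sInf_mem ⟨m, hm, fun b hb => by rw [measure_traj_eq hU]; exact hm' b hb⟩
  refine ⟨hmem.1, fun b hb => ?_⟩
  have h := hmem.2 b hb
  rw [measure_traj_eq hU] at h
  -- The definition of `n₀` starts the trajectories at time `0`, the window `I_0` at time `l_0`; a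
  -- shift identifies the two.
  rw [← (measurePreserving_shiftPoint p (-winStart n0 0)).measure_preimage
    (measurableSet_coalesces b 0).nullMeasurableSet]
  refine (h.trans_le (measure_mono fun u hu => ?_)).ne'
  show Coalesces p n0 b 0 (timeShift (-winStart n0 0) (numbers u))
  intro a
  rw [startTraj_timeShift, add_neg_cancel, ← hu a, startTraj]
  simp only [numbers, zero_add]

end Main

end ProbKernel

theorem theorem5 {A : Type*} [Fintype A] [LinearOrder A] (p : ProbKernel A)
    (hadd : ∀ x ∈ p.admissible, ∀ g : A, 0 < p.prob g x → ProbKernel.prepend [g] x ∈ p.admissible)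
    (hp : p.StandingAssumption)
    {Ω : Type*} [MeasurableSpace Ω] (μ : Measure Ω) [IsProbabilityMeasure μ]
    (U : ℤ → p.Start → Ω → ℝ)
    (hmeas : ∀ m a, Measurable (U m a))
    (hunif : ∀ m a, μ.map (U m a) = (volume : Measure ℝ).restrict (Set.Ico 0 1))
    (hindep : iIndepFun (fun i : ℤ × p.Start => U i.1 i.2) μ)
    (n0 : ℕ) (hn0 : n0 = p.nZero μ (fun t a => U (t : ℤ) a))
    (c L : ℝ) (hc : 0 < c) (hL : Tendsto p.rhoTilde atTop (𝓝 L)) (hcL : c ≤ L) :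
    (∫⁻ ω, (p.Ttilde n0 (fun m a => U m a ω) 0).abs ∂μ < ⊤) ∧
    (∀ n : ℤ, 1 ≤ n → ∫⁻ ω, (p.TtildeIcc n0 (fun m a => U m a ω) 0 n).abs ∂μ < ⊤) ∧
    (∀ᵐ ω ∂μ, (p.TtildeIci n0 (fun m a => U m a ω) 0).abs < ⊤) := by
  have hU := ProbKernel.measurePreserving_driving hmeas hunif hindep
  have hn : 1 ≤ p.nHat := hp.goodOrder_nHat.1
  obtain ⟨hle, hcoal⟩ := ProbKernel.nZero_spec hadd hp hU hn0
  have hpos : 0 < n0 := by omega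
  obtain ⟨x, hx, δ, hδ, hρ⟩ := ProbKernel.exists_rho_ge hc hL hcL
  have hq := ProbKernel.measure_survives_forever_pos hadd hn hle hδ hρ (hcoal x hx)
  refine ⟨?_, fun n h1 => ProbKernel.lintegral_abs_TtildeIcc_lt_top hpos hq hU (by omega),
    ProbKernel.ae_abs_TtildeIci_lt_top hpos hq hU⟩
  -- The first claim is the degenerate interval `T̃[0, 0] = T̃[0]`.
  have h := ProbKernel.lintegral_abs_TtildeIcc_lt_top hpos hq hU (le_refl (0 : ℤ))
  simpa [ProbKernel.TtildeIcc] using h
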